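/- Let $(\Omega,\mu)$ be an atomless standard Borel probability space. Let $M$ be a separable (one-sorted) metric structure with at least two elements in a countable language $L$, in the sense of continuous logic: a complete, separable, bounded metric space $(M,d)$, together with uniformly continuous functions $M^n\to M$ and bounded uniformly continuous predicates $M^n\to\mathbb{R}$ interpreting the symbols of $L$. A definable predicate $\varphi\colon M^n\to[0,1]$ is a $[0,1]$-valued uniform limit of interpretations of $L$-formulas (without parameters). For a metric space $X$ with bounded metric $d$, let $L^0(\Omega,X)$ be the space of $X$-valued random variables on $\Omega$ up to a.e. equality, with the metric $d^\Omega(r,s)=\int d(r(\omega),s(\omega))\,d\mu(\omega)$; for a Polish space $X$, $L^0(\Omega,X)$ carries the topology induced in this way by any compatible bounded metric on $X$. The Borel randomization $M^R$ is the two-sorted metric structure with main sort $L^0(\Omega,M)$ and auxiliary sort $\mathbb{A}=L^0(\Omega,[0,1])$ (both with the metric $d^\Omega$), with, for every definable predicate $\varphi\colon M^n\to[0,1]$, the function $[\![\varphi]\!]\colon L^0(\Omega,M)^n\to\mathbb{A}$, $[\![\varphi(r)]\!](\omega)=\varphi(r(\omega))$; with the pointwise operations $0$, $1-x$, $x/2$,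 $\max(x-y,0)$ on $\mathbb{A}$; and with the expectation predicate $\mathbb{E}\colon\mathbb{A}\to[0,1]$. Automorphism groups of metric structures carry the topology of pointwise convergence (on all sorts). Let $\mathrm{Aut}(\Omega)$ be the group of invertible measure-preserving transformations of $\Omega$ up to a.e. equality, with the topology of pointwise convergence of its action $(tR)(\omega)=R(t^{-1}(\omega))$ on $\mathbb{A}$. For a Polish group $G$, the group $L^0(\Omega,G)$ has pointwise multiplication, $\mathrm{Aut}(\Omega)$ acts on it by $(t\cdot g)(\omega)=g(t^{-1}(\omega))$, and the measurable wreath product is $G\wr\Omega=L^0(\Omega,G)\rtimes\mathrm{Aut}(\Omega)$ with the product topology. Theorem. $\mathrm{Aut}(M^R)=\mathrm{Aut}(M)\wr\Omega$ as topological groups. More precisely, there is an isomorphism of topological groups $e\colon\mathrm{Aut}(M)\wr\Omega\to\mathrm{Aut}(M^R)$ such that $e(g,t)$ acts on the main sort by $r\mapsto\big(\omega\mapsto g(\omega)(r(t^{-1}(\omega)))\big)$ and on the auxiliary sort by $R\mapsto\big(\omega\mapsto R(t^{-1}(\omega))\big)$, for all $g\in L^0(\Omega,\mathrm{Aut}(M))$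 and $t\in\mathrm{Aut}(\Omega)$. -/

import Mathlib

open MeasureTheory Topology

universe u v w z

noncomputable section

namespace MetricRandomization

/-! ### Metric structures, one-sorted -/

/-- Interpretations of the symbols of a one-sorted language `L` in a metric space `M`, in the sense
of continuous logic: the function symbols are interpreted by uniformly continuous functions, and
the relation symbols by bounded, uniformly continuous, real-valued predicates. The metric of `M`
interprets equality. (Completeness, boundedness and separability of `M` are expressed by the
corresponding type classes.) -/
class MetricStructure (L : FirstOrder.Language.{u, v}) (M : Type w) [MetricSpace M] where
  funMap : ∀ {n : ℕ}, L.Functions n → (Fin n → M) → M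
  predMap : ∀ {n : ℕ}, L.Relations n → (Fin n → M) → ℝ
  uniformContinuous_funMap : ∀ {n : ℕ} (f : L.Functions n), UniformContinuous (funMap f)
  uniformContinuous_predMap : ∀ {n : ℕ} (P : L.Relations n), UniformContinuous (predMap P)
  bounded_predMap : ∀ {n : ℕ} (P : L.Relations n), ∃ C : ℝ, ∀ x, |predMap P x| ≤ C

/-- Formulas of continuous logic in the free variables `0, …, n - 1`. In the quantified formulas
`sup φ` and `inf φ` the bound variable is the last variable of `φ`. -/
inductive MetricFormula (L : FirstOrder.Language.{u, v}) : ℕ → Type (max u v)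
  | pred {n k : ℕ} (P : L.Relations k) (ts : Fin k → L.Term (Fin n)) : MetricFormula L n
  | dist {n : ℕ} (t₁ t₂ : L.Term (Fin n)) : MetricFormula L n
  | connective {n k : ℕ} (θ : C(Fin k → ℝ, ℝ)) (φ : Fin k → MetricFormula L n) : MetricFormula L n
  | sup {n : ℕ} (φ : MetricFormula L (n + 1)) : MetricFormula L n
  | inf {n : ℕ} (φ : MetricFormula L (n + 1)) : MetricFormula L n

section OneSorted

variable {L : FirstOrder.Language.{u, v}} {M : Type w} [MetricSpace M] [MetricStructure L M]

/-- The value in `M` of a term. -/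
def termValue {α : Type*} (x : α → M) : L.Term α → M
  | .var i => x i
  | .func f ts => MetricStructure.funMap f fun i => termValue x (ts i)

/-- The value in `M` of a formula. -/
def MetricFormula.value : {n : ℕ} → MetricFormula L n → (Fin n → M) → ℝ
  | _, .pred P ts, x => MetricStructure.predMap P fun i => termValue x (ts i)
  | _, .dist t₁ t₂, x => Dist.dist (termValue x t₁) (termValue x t₂)
  | _, .connective θ φ, x => θ fun i => (φ i).value x
  | _, .sup φ, x => ⨆ y : M, φ.value (Fin.snoc x y)
  | _, .inf φ, x => ⨅ y : M, φ.value (Fin.snoc x y)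

variable (L M) in
/-- The definable predicates `M ^ n → [0, 1]` (without parameters): the `[0, 1]`-valued functions
that are uniform limits of values of formulas. -/
def IsDefinablePredicate {n : ℕ} (φ : (Fin n → M) → unitInterval) : Prop :=
  ∀ ε > 0, ∃ ψ : MetricFormula L n, ∀ x, |(φ x : ℝ) - ψ.value x| ≤ ε

theorem uniformContinuous_termValue {n : ℕ} (t : L.Term (Fin n)) :
    UniformContinuous fun x : Fin n → M => termValue x t := by
  induction t with
  | var i => exact Pi.uniformContinuous_proj _ i
  | func f ts ih =>
    exact (MetricStructure.uniformContinuous_funMap f).comp (uniformContinuous_pi.2 ih)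

theorem dist_snoc_le {n : ℕ} (x x' : Fin n → M) (y : M) :
    Dist.dist (Fin.snoc x y : Fin (n + 1) → M) (Fin.snoc x' y) ≤ Dist.dist x x' := by
  refine (dist_pi_le_iff dist_nonneg).2 fun i => ?_
  refine Fin.lastCases ?_ (fun j => ?_) i
  · simp
  · simpa using dist_le_pi_dist x x' j

theorem MetricFormula.uniformContinuous_and_bounded [BoundedSpace M] [Nonempty M] {n : ℕ}
    (φ : MetricFormula L n) :
    UniformContinuous (φ.value : (Fin n → M) → ℝ) ∧
      ∃ C : ℝ, ∀ x : Fin n → M, |φ.value x| ≤ C := by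
  induction φ with
  | pred P ts =>
    obtain ⟨C, hC⟩ := MetricStructure.bounded_predMap (M := M) P
    exact ⟨(MetricStructure.uniformContinuous_predMap P).comp
      (uniformContinuous_pi.2 fun i => uniformContinuous_termValue (ts i)), C, fun x => hC _⟩
  | dist t₁ t₂ =>
    refine ⟨(uniformContinuous_termValue t₁).dist (uniformContinuous_termValue t₂),
      Metric.diam (Set.univ : Set M), fun x => ?_⟩
    rw [MetricFormula.value, abs_of_nonneg dist_nonneg]
    exact Metric.dist_le_diam_of_mem (Bornology.IsBounded.all _) trivial trivial
  | @connective n k θ φ ih =>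
    choose h1 C hC using ih
    let K : Set (Fin k → ℝ) := Set.univ.pi fun i => Set.Icc (-C i) (C i)
    have hK : IsCompact K := isCompact_univ_pi fun i => isCompact_Icc
    have hmem : ∀ x : Fin n → M, (fun i => (φ i).value x) ∈ K := fun x i _ => abs_le.1 (hC i x)
    have hu : UniformContinuousOn θ K :=
      hK.uniformContinuousOn_of_continuous θ.continuous.continuousOn
    have hf : UniformContinuous fun x : Fin n → M => fun i => (φ i).value x :=
      uniformContinuous_pi.2 h1
    constructor
    · rw [Metric.uniformContinuous_iff]
      intro ε hε
      obtain ⟨δ, hδ, h⟩ := Metric.uniformContinuousOn_iff.1 hu ε hε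
      obtain ⟨η, hη, h'⟩ := Metric.uniformContinuous_iff.1 hf δ hδ
      exact ⟨η, hη, fun {a b} hab => h _ (hmem a) _ (hmem b) (h' hab)⟩
    · obtain ⟨B, hB⟩ := hK.exists_bound_of_continuousOn (f := θ) θ.continuous.continuousOn
      exact ⟨B, fun x => hB _ (hmem x)⟩
  | @sup n φ ih =>
    obtain ⟨h, C, hC⟩ := ih
    have bdd : ∀ x : Fin n → M, BddAbove (Set.range fun y : M => φ.value (Fin.snoc x y)) :=
      fun x => ⟨C, by rintro _ ⟨y, rfl⟩; exact (abs_le.1 (hC _)).2⟩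
    constructor
    · rw [Metric.uniformContinuous_iff] at h ⊢
      intro ε hε
      obtain ⟨δ, hδ, h⟩ := h (ε / 2) (half_pos hε)
      have key : ∀ a b : Fin n → M, Dist.dist a b < δ →
          (⨆ y : M, φ.value (Fin.snoc a y)) ≤ (⨆ y : M, φ.value (Fin.snoc b y)) + ε / 2 := by
        intro a b hab
        refine ciSup_le fun y => ?_
        have h1 := h (lt_of_le_of_lt (dist_snoc_le a b y) hab)
        have h2 := le_ciSup (bdd b) y
        rw [Real.dist_eq, abs_lt] at h1
        linarith [h1.2]
      refine ⟨δ, hδ, fun {a b} hab => ?_⟩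
      have h1 := key a b hab
      have h2 := key b a (by rwa [dist_comm])
      simp only [MetricFormula.value]
      rw [Real.dist_eq, abs_lt]
      constructor <;> linarith
    · refine ⟨C, fun x => abs_le.2 ⟨?_, ciSup_le fun y => (abs_le.1 (hC _)).2⟩⟩
      obtain ⟨y⟩ := (inferInstance : Nonempty M)
      exact le_trans (abs_le.1 (hC (Fin.snoc x y))).1 (le_ciSup (bdd x) y)
  | @inf n φ ih =>
    obtain ⟨h, C, hC⟩ := ih
    have bdd : ∀ x : Fin n → M, BddBelow (Set.range fun y : M => φ.value (Fin.snoc x y)) :=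
      fun x => ⟨-C, by rintro _ ⟨y, rfl⟩; exact (abs_le.1 (hC _)).1⟩
    constructor
    · rw [Metric.uniformContinuous_iff] at h ⊢
      intro ε hε
      obtain ⟨δ, hδ, h⟩ := h (ε / 2) (half_pos hε)
      have key : ∀ a b : Fin n → M, Dist.dist a b < δ →
          (⨅ y : M, φ.value (Fin.snoc a y)) - ε / 2 ≤ (⨅ y : M, φ.value (Fin.snoc b y)) := by
        intro a b hab
        refine le_ciInf fun y => ?_
        have h1 := h (lt_of_le_of_lt (dist_snoc_le a b y) hab)
        have h2 := ciInf_le (bdd a) y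
        rw [Real.dist_eq, abs_lt] at h1
        linarith [h1.2]
      refine ⟨δ, hδ, fun {a b} hab => ?_⟩
      have h1 := key a b hab
      have h2 := key b a (by rwa [dist_comm])
      simp only [MetricFormula.value]
      rw [Real.dist_eq, abs_lt]
      constructor <;> linarith
    · refine ⟨C, fun x => abs_le.2 ⟨le_ciInf fun y => (abs_le.1 (hC _)).1, ?_⟩⟩
      obtain ⟨y⟩ := (inferInstance : Nonempty M)
      exact le_trans (ciInf_le (bdd x) y) (abs_le.1 (hC (Fin.snoc x y))).2

theorem IsDefinablePredicate.continuous [BoundedSpace M] [Nonempty M] {n : ℕ}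
    {φ : (Fin n → M) → unitInterval} (h : IsDefinablePredicate L M φ) : Continuous φ := by
  refine Continuous.subtype_mk (f := fun x => (φ x : ℝ)) ?_ fun x => (φ x).2
  refine Metric.continuous_iff.2 fun b ε hε => ?_
  obtain ⟨ψ, hψ⟩ := h (ε / 3) (by positivity)
  obtain ⟨δ, hδ, hc⟩ :=
    Metric.uniformContinuous_iff.1 (ψ.uniformContinuous_and_bounded (M := M)).1 (ε / 3)
      (by positivity)
  refine ⟨δ, hδ, fun a hab => ?_⟩
  have h1 := abs_le.1 (hψ a)
  have h2 := abs_le.1 (hψ b)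
  have h3 := hc hab
  rw [Real.dist_eq, abs_lt] at h3 ⊢
  constructor <;> linarith [h1.1, h1.2, h2.1, h2.2, h3.1, h3.2]

end OneSorted

/-! ### Isometry groups and automorphism groups -/

section Isometries

variable {X : Type w} [MetricSpace X]

/-- The topology of pointwise convergence on the isometry group of `X`. -/
instance isometryTopology : TopologicalSpace (X ≃ᵢ X) :=
  TopologicalSpace.induced (fun g x => g x) Pi.topologicalSpace

theorem continuous_eval_isometry (x : X) : Continuous fun g : X ≃ᵢ X => g x :=
  (continuous_apply x).comp (continuous_induced_dom (f := fun (g : X ≃ᵢ X) x => g x))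

theorem continuous_isometry_iff {Y : Type*} [TopologicalSpace Y] {F : Y → (X ≃ᵢ X)} :
    Continuous F ↔ ∀ x, Continuous fun y => F y x := by
  rw [continuous_induced_rng, continuous_pi_iff]
  rfl

instance isometryTopologicalGroup : IsTopologicalGroup (X ≃ᵢ X) where
  continuous_mul := by
    refine continuous_isometry_iff.2 fun x => continuous_iff_continuousAt.2 fun p => ?_
    refine tendsto_iff_dist_tendsto_zero.2 ?_
    have h1 : Filter.Tendsto (fun q : (X ≃ᵢ X) × (X ≃ᵢ X) =>
        dist (q.2 x) (p.2 x) + dist (q.1 (p.2 x)) (p.1 (p.2 x))) (𝓝 p) (𝓝 (0 + 0)) := by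
      refine Filter.Tendsto.add ?_ ?_
      · exact tendsto_iff_dist_tendsto_zero.1
          (((continuous_eval_isometry x).comp continuous_snd).tendsto p)
      · exact tendsto_iff_dist_tendsto_zero.1
          (((continuous_eval_isometry (p.2 x)).comp continuous_fst).tendsto p)
    rw [add_zero] at h1
    refine squeeze_zero (fun _ => dist_nonneg) (fun q => ?_) h1
    calc dist ((q.1 * q.2) x) ((p.1 * p.2) x) = dist (q.1 (q.2 x)) (p.1 (p.2 x)) := rfl
      _ ≤ dist (q.1 (q.2 x)) (q.1 (p.2 x)) + dist (q.1 (p.2 x)) (p.1 (p.2 x)) :=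
        dist_triangle _ _ _
      _ = _ := by rw [q.1.isometry.dist_eq]
  continuous_inv := by
    refine continuous_isometry_iff.2 fun x => continuous_iff_continuousAt.2 fun p => ?_
    refine tendsto_iff_dist_tendsto_zero.2 ?_
    have h1 := tendsto_iff_dist_tendsto_zero.1
      ((continuous_eval_isometry (p⁻¹ x)).tendsto p)
    refine h1.congr fun q => ?_
    have e1 : p (p⁻¹ x) = x := p.apply_symm_apply x
    have e2 : q (q⁻¹ x) = x := q.apply_symm_apply x
    rw [e1]
    calc dist (q (p⁻¹ x)) x = dist (q (p⁻¹ x)) (q (q⁻¹ x)) := by rw [e2]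
      _ = dist (p⁻¹ x) (q⁻¹ x) := q.isometry.dist_eq _ _
      _ = dist (q⁻¹ x) (p⁻¹ x) := dist_comm _ _

instance isometryMetrizable [TopologicalSpace.SeparableSpace X] :
    TopologicalSpace.MetrizableSpace (X ≃ᵢ X) := by
  obtain ⟨D, hDc, hD⟩ := TopologicalSpace.exists_countable_dense X
  have : Countable D := hDc
  let Φ : (X ≃ᵢ X) → (D → X) := fun g d => g d
  have hinj : Function.Injective Φ := fun g h hgh => by
    refine IsometryEquiv.ext fun x => ?_
    exact congrFun (Continuous.ext_on hD g.continuous h.continuous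
      fun d hd => congrFun hgh ⟨d, hd⟩) x
  have hcont : Continuous Φ := continuous_pi fun d => continuous_eval_isometry (d : X)
  have hind : IsInducing Φ := by
    refine ⟨le_antisymm (continuous_iff_le_induced.1 hcont) ?_⟩
    rw [← continuous_id_iff_le]
    let : TopologicalSpace (X ≃ᵢ X) := TopologicalSpace.induced Φ inferInstance
    refine continuous_induced_rng.2 (continuous_pi fun x => continuous_iff_continuousAt.2
      fun p => Metric.tendsto_nhds.2 fun ε hε => ?_)
    obtain ⟨d, hd, hxd⟩ := Metric.dense_iff.1 hD x (ε / 3) (by positivity)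
    have hc : Continuous fun g : X ≃ᵢ X => g d :=
      (continuous_apply (⟨d, hxd⟩ : D)).comp (continuous_induced_dom (f := Φ))
    filter_upwards [Metric.tendsto_nhds.1 (hc.tendsto p) (ε / 3) (by positivity)] with q hq
    have hd' : dist d x < ε / 3 := hd
    calc dist (q x) (p x) ≤ dist (q x) (q d) + dist (q d) (p d) + dist (p d) (p x) :=
          dist_triangle4 _ _ _ _
      _ = dist x d + dist (q d) (p d) + dist d x := by
          rw [q.isometry.dist_eq, p.isometry.dist_eq]
      _ < ε := by rw [dist_comm x d]; linarith
  exact (Topology.IsEmbedding.mk hind hinj).metrizableSpace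

end Isometries

/-- The automorphism group `Aut(M)` of a metric structure. As a subgroup of the isometry group, it
carries the topology of pointwise convergence. -/
def Aut (L : FirstOrder.Language.{u, v}) (M : Type w) [MetricSpace M] [MetricStructure L M] :
    Subgroup (M ≃ᵢ M) where
  carrier := {g | (∀ (n : ℕ) (f : L.Functions n) (x : Fin n → M),
      g (MetricStructure.funMap f x) = MetricStructure.funMap f fun i => g (x i)) ∧
    ∀ (n : ℕ) (P : L.Relations n) (x : Fin n → M),
      (MetricStructure.predMap P fun i => g (x i)) = MetricStructure.predMap P x}
  one_mem' := ⟨fun _ _ _ => rfl, fun _ _ _ => rfl⟩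
  mul_mem' := by
    rintro g h ⟨hg, hg'⟩ ⟨hh, hh'⟩
    refine ⟨fun n f x => ?_, fun n P x => ?_⟩
    · simp only [IsometryEquiv.mul_apply, hh, hg]
    · simp only [IsometryEquiv.mul_apply, hh', hg']
  inv_mem' := by
    rintro g ⟨hg, hg'⟩
    have e : ∀ x, g (g⁻¹ x) = x := g.apply_symm_apply
    refine ⟨fun n f x => ?_, fun n P x => ?_⟩
    · apply g.injective
      rw [hg]
      simp only [e]
    · rw [← hg']
      simp only [e]

instance autMetrizable (L : FirstOrder.Language.{u, v}) (M : Type w) [MetricSpace M]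
    [TopologicalSpace.SeparableSpace M] [MetricStructure L M] :
    TopologicalSpace.MetrizableSpace (Aut L M) :=
  Topology.IsEmbedding.subtypeVal.metrizableSpace

/-- The data of a many-sorted metric structure, with set of sorts `S`: a metric space for each sort,
and function symbols and predicate symbols with their arities, sorts and interpretations. -/
structure ManySorted (S : Type) where
  Carrier : S → Type w
  metric : ∀ s, MetricSpace (Carrier s)
  /-- the function symbols -/
  Func : Type w
  funcArity : Func → ℕ
  funcDom : (f : Func) → Fin (funcArity f) → S
  funcCod : Func → S
  funMap : (f : Func) → (∀ i, Carrier (funcDom f i)) → Carrier (funcCod f)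
  /-- the predicate symbols -/
  Pred : Type w
  predArity : Pred → ℕ
  predDom : (P : Pred) → Fin (predArity P) → S
  predMap : (P : Pred) → (∀ i, Carrier (predDom P i)) → ℝ

attribute [instance] ManySorted.metric

/-- The automorphism group of a many-sorted metric structure: the families of surjective isometries
of the sorts that respect all function and predicate symbols. It carries the topology of pointwise
convergence on all sorts. -/
def ManySorted.Aut {S : Type} (N : ManySorted.{w} S) :
    Subgroup (∀ s, N.Carrier s ≃ᵢ N.Carrier s) where
  carrier := {σ | (∀ (f : N.Func) (x : ∀ i, N.Carrier (N.funcDom f i)),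
      σ _ (N.funMap f x) = N.funMap f fun i => σ _ (x i)) ∧
    ∀ (P : N.Pred) (x : ∀ i, N.Carrier (N.predDom P i)),
      (N.predMap P fun i => σ _ (x i)) = N.predMap P x}
  one_mem' := ⟨fun _ _ => rfl, fun _ _ => rfl⟩
  mul_mem' := by
    rintro g h ⟨hg, hg'⟩ ⟨hh, hh'⟩
    refine ⟨fun f x => ?_, fun P x => ?_⟩
    · simp only [Pi.mul_apply, IsometryEquiv.mul_apply, hh, hg]
    · simp only [Pi.mul_apply, IsometryEquiv.mul_apply, hg', hh']
  inv_mem' := by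
    rintro g ⟨hg, hg'⟩
    have e : ∀ s x, g s ((g⁻¹) s x) = x := fun s => (g s).apply_symm_apply
    refine ⟨fun f x => ?_, fun P x => ?_⟩
    · apply (g _).injective
      rw [hg]
      simp only [e]
    · rw [← hg']
      simp only [e]

/-! ### Spaces of random variables -/

/-- A bounded metric on `X`, presented as a function `ρ` that is continuous on `X × X`. -/
structure IsBoundedMetric {X : Type*} [TopologicalSpace X] (ρ : X → X → ℝ) : Prop where
  continuous : Continuous fun p : X × X => ρ p.1 p.2
  self : ∀ x, ρ x x = 0
  comm : ∀ x y, ρ x y = ρ y x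
  triangle : ∀ x y z, ρ x z ≤ ρ x y + ρ y z
  eq_of_zero : ∀ x y, ρ x y = 0 → x = y
  bounded : ∃ C : ℝ, ∀ x y, ρ x y ≤ C

theorem IsBoundedMetric.nonneg {X : Type*} [TopologicalSpace X] {ρ : X → X → ℝ}
    (h : IsBoundedMetric ρ) (x y : X) : 0 ≤ ρ x y := by
  have h1 := h.triangle x y x
  rw [h.self, h.comm y x] at h1
  linarith

theorem isBoundedMetric_dist (X : Type*) [MetricSpace X] [BoundedSpace X] :
    IsBoundedMetric (dist : X → X → ℝ) where
  continuous := continuous_dist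
  self := dist_self
  comm := dist_comm
  triangle := dist_triangle
  eq_of_zero _ _ := eq_of_dist_eq_zero
  bounded := ⟨Metric.diam (Set.univ : Set X), fun _ _ =>
    Metric.dist_le_diam_of_mem (Bornology.IsBounded.all _) trivial trivial⟩

/-- A bounded metric compatible with the topology of a metrizable space: the truncation at `1` of
a compatible metric. -/
def compatibleDist (X : Type*) [TopologicalSpace X] [TopologicalSpace.MetrizableSpace X]
    (x y : X) : ℝ :=
  letI := TopologicalSpace.metrizableSpaceMetric X
  min 1 (dist x y)

theorem isBoundedMetric_compatibleDist (X : Type*) [TopologicalSpace X]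
    [TopologicalSpace.MetrizableSpace X] : IsBoundedMetric (compatibleDist X) := by
  let := TopologicalSpace.metrizableSpaceMetric X
  have e : compatibleDist X = fun x y => min 1 (dist x y) := rfl
  refine ⟨?_, ?_, ?_, ?_, ?_, ?_⟩
  · rw [e]; fun_prop
  · intro x; simp [e]
  · intro x y; simp [e, dist_comm]
  · intro x y z
    have h := dist_triangle x y z
    have h1 : 0 ≤ dist x y := dist_nonneg
    have h2 : 0 ≤ dist y z := dist_nonneg
    simp only [e]
    rcases le_total 1 (dist x y) with h3 | h3 <;> rcases le_total 1 (dist y z) with h4 | h4 <;>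
      simp only [h3, h4, min_eq_left, min_eq_right] <;>
      linarith [min_le_left 1 (dist x z), min_le_right 1 (dist x z)]
  · intro x y h
    simp only [e] at h
    rcases min_choice 1 (dist x y) with h1 | h1
    · rw [h1] at h; norm_num at h
    · rw [h1] at h; exact eq_of_dist_eq_zero h
  · exact ⟨1, fun x y => min_le_left _ _⟩

section RandomVariables

variable {Ω : Type z} [MeasurableSpace Ω] {μ : Measure Ω} [IsProbabilityMeasure μ]

theorem IsBoundedMetric.integrable {X : Type*} [TopologicalSpace X] {ρ : X → X → ℝ}
    (h : IsBoundedMetric ρ) (r s : Ω →ₘ[μ] X) : Integrable (fun ω => ρ (r ω) (s ω)) μ := by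
  obtain ⟨C, hC⟩ := h.bounded
  refine Integrable.of_bound (C := C) ?_ (Filter.Eventually.of_forall fun ω => ?_)
  · exact h.continuous.comp_aestronglyMeasurable
      (r.aestronglyMeasurable.prodMk s.aestronglyMeasurable)
  · rw [Real.norm_eq_abs, abs_of_nonneg (h.nonneg _ _)]
    exact hC _ _

/-- The metric `d(r, s) = ∫ ρ (r ω) (s ω) dμ(ω)` on the space `L⁰(Ω, X)` of random variables. -/
@[reducible]
def integralMetric (μ : Measure Ω) [IsProbabilityMeasure μ] {X : Type*} [TopologicalSpace X]
    {ρ : X → X → ℝ} (h : IsBoundedMetric ρ) : MetricSpace (Ω →ₘ[μ] X) where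
  dist r s := ∫ ω, ρ (r ω) (s ω) ∂μ
  dist_self r := by simp [h.self]
  dist_comm r s := by simp only [h.comm]
  dist_triangle r s t := by
    rw [← integral_add (h.integrable r s) (h.integrable s t)]
    exact integral_mono (h.integrable r t) ((h.integrable r s).add (h.integrable s t))
      fun ω => h.triangle _ _ _
  eq_of_dist_eq_zero {r s} hrs := by
    have h0 := (integral_eq_zero_iff_of_nonneg (fun ω => h.nonneg _ _) (h.integrable r s)).1 hrs
    refine AEEqFun.ext ?_
    filter_upwards [h0] with ω hω
    exact h.eq_of_zero _ _ hω

/-- The topology of `L⁰(Ω, X)` for a metrizable space `X`, given by the metric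
`∫ ρ (r ω) (s ω) dμ(ω)` for a compatible bounded metric `ρ` (its choice is immaterial). -/
@[reducible]
def randomTopology (μ : Measure Ω) [IsProbabilityMeasure μ] (X : Type*) [TopologicalSpace X]
    [TopologicalSpace.MetrizableSpace X] : TopologicalSpace (Ω →ₘ[μ] X) :=
  (integralMetric μ (isBoundedMetric_compatibleDist X)).toUniformSpace.toTopologicalSpace

end RandomVariables

/-! ### The Borel randomization -/

section Randomization

/-- The two sorts of the randomization language. -/
inductive RSort
  /-- random elements of `M` -/
  | main
  /-- `[0, 1]`-valued random variables -/
  | aux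

/-- The function symbols of the randomization: `⟦φ⟧` for every definable predicate `φ` of `M`, and
the symbols `0`, `1 - x`, `x / 2` and truncated subtraction `max (x - y) 0` of the theory of
`[0, 1]`-valued random variables. -/
inductive RFunc (L : FirstOrder.Language.{u, v}) (M : Type w) [MetricSpace M]
    [MetricStructure L M] : Type w
  | event (n : ℕ) (φ : (Fin n → M) → unitInterval) (h : IsDefinablePredicate L M φ)
  | zero
  | neg
  | half
  | monus

/-- The only predicate symbol of the randomization is the expectation on the auxiliary sort. -/
inductive RPred : Type w
  | expectation

/-- `x / 2` on `[0, 1]` -/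
def unitHalf (x : unitInterval) : unitInterval :=
  ⟨(x : ℝ) / 2, by linarith [x.2.1], by linarith [x.2.1, x.2.2]⟩

/-- truncated subtraction `max (x - y) 0` on `[0, 1]` -/
def unitMonus (x y : unitInterval) : unitInterval :=
  ⟨max ((x : ℝ) - y) 0, le_max_right _ _, max_le (by linarith [x.2.2, y.2.1]) zero_le_one⟩

theorem continuous_unitHalf : Continuous unitHalf :=
  Continuous.subtype_mk (by fun_prop) _

theorem continuous_unitMonus : Continuous (Function.uncurry unitMonus) :=
  Continuous.subtype_mk (by fun_prop) _

variable {Ω : Type w} [MeasurableSpace Ω] (μ : Measure Ω)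

theorem stronglyMeasurable_tuple {M : Type w} [MetricSpace M] [TopologicalSpace.SeparableSpace M]
    {n : ℕ} (r : Fin n → (Ω →ₘ[μ] M)) : StronglyMeasurable fun ω => fun i => r i ω := by
  have : SecondCountableTopology M := UniformSpace.secondCountable_of_separable M
  borelize M
  exact (measurable_pi_lambda _ fun i => (r i).measurable).stronglyMeasurable

/-- The random variable `⟦φ(r)⟧ : ω ↦ φ (r₁ ω, …, rₙ ω)`. -/
def eventMap {M : Type w} [MetricSpace M] [TopologicalSpace.SeparableSpace M] {n : ℕ}
    {φ : (Fin n → M) → unitInterval} (hφ : Continuous φ) (r : Fin n → (Ω →ₘ[μ] M)) :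
    Ω →ₘ[μ] unitInterval :=
  AEEqFun.mk (fun ω => φ fun i => r i ω)
    (hφ.comp_aestronglyMeasurable (stronglyMeasurable_tuple μ r).aestronglyMeasurable)

/-- The Borel randomization of `M` over the probability space `(Ω, μ)`. Its main sort is
`L⁰(Ω, M)` and its auxiliary sort is `L⁰(Ω, [0, 1])`, both with the metric
`(r, s) ↦ ∫ d (r ω) (s ω) dμ(ω)`. -/
def borelRandomization [IsProbabilityMeasure μ] (L : FirstOrder.Language.{u, v}) (M : Type w)
    [MetricSpace M] [BoundedSpace M] [TopologicalSpace.SeparableSpace M] [Nonempty M]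
    [MetricStructure L M] : ManySorted.{w} RSort where
  Carrier
    | .main => Ω →ₘ[μ] M
    | .aux => Ω →ₘ[μ] unitInterval
  metric
    | .main => integralMetric μ (isBoundedMetric_dist M)
    | .aux => integralMetric μ (isBoundedMetric_dist unitInterval)
  Func := RFunc L M
  funcArity
    | .event n _ _ => n
    | .zero => 0
    | .neg => 1
    | .half => 1
    | .monus => 2
  funcDom
    | .event _ _ _ => fun _ => .main
    | .zero => fun _ => .aux
    | .neg => fun _ => .aux
    | .half => fun _ => .aux
    | .monus => fun _ => .aux
  funcCod _ := .aux
  funMap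
    | .event _ _ h => fun r => eventMap μ h.continuous r
    | .zero => fun _ => AEEqFun.const Ω (0 : unitInterval)
    | .neg => fun R => AEEqFun.comp unitInterval.symm unitInterval.continuous_symm (R 0)
    | .half => fun R => AEEqFun.comp unitHalf continuous_unitHalf (R 0)
    | .monus => fun R => AEEqFun.comp₂ unitMonus continuous_unitMonus (R 0) (R 1)
  Pred := RPred
  predArity _ := 1
  predDom _ := fun _ => .aux
  predMap
    | .expectation => fun R => ∫ ω, ((R 0 : Ω →ₘ[μ] unitInterval) ω : ℝ) ∂μ

variable [IsProbabilityMeasure μ] {L : FirstOrder.Language.{u, v}} {M : Type w} [MetricSpace M]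
  [BoundedSpace M] [TopologicalSpace.SeparableSpace M] [Nonempty M] [MetricStructure L M] {μ}

/-- The action of an automorphism of the randomization on the main sort. -/
def onMain (σ : (borelRandomization μ L M).Aut) (r : Ω →ₘ[μ] M) : Ω →ₘ[μ] M :=
  σ.1 RSort.main r

/-- The action of an automorphism of the randomization on the auxiliary sort. -/
def onAux (σ : (borelRandomization μ L M).Aut) (R : Ω →ₘ[μ] unitInterval) :
    Ω →ₘ[μ] unitInterval :=
  σ.1 RSort.aux R

end Randomization

/-! ### The measurable wreath product -/

section Wreath

variable {Ω : Type z} [MeasurableSpace Ω] (μ : Measure Ω)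

/-- The group of invertible measure-preserving transformations of `(Ω, μ)`. -/
def measurePreservingPerms : Subgroup (Equiv.Perm Ω) where
  carrier := {t | MeasurePreserving t μ μ ∧ MeasurePreserving t.symm μ μ}
  one_mem' := ⟨MeasurePreserving.id μ, MeasurePreserving.id μ⟩
  mul_mem' := fun ha hb => ⟨ha.1.comp hb.1, hb.2.comp ha.2⟩
  inv_mem' := fun ha => ⟨ha.2, ha.1⟩

/-- The invertible measure-preserving transformations that are almost everywhere the identity. -/
def aeTrivialPerms : Subgroup (measurePreservingPerms μ) where
  carrier := {t | ∀ᵐ ω ∂μ, t.1 ω = ω}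
  one_mem' := by
    change ∀ᵐ ω ∂μ, (1 : Equiv.Perm Ω) ω = ω
    exact Filter.Eventually.of_forall fun _ => rfl
  mul_mem' := by
    intro a b ha hb
    change ∀ᵐ ω ∂μ, (a * b).1 ω = ω
    filter_upwards [ha, hb] with ω h1 h2
    change a.1 (b.1 ω) = ω
    rw [h2, h1]
  inv_mem' := by
    intro a ha
    change ∀ᵐ ω ∂μ, (a⁻¹).1 ω = ω
    filter_upwards [ha] with ω h1
    change a.1.symm ω = ω
    rw [Equiv.symm_apply_eq, h1]

instance aeTrivialPerms_normal : (aeTrivialPerms μ).Normal where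
  conj_mem := by
    intro n hn g
    filter_upwards [g.2.2.quasiMeasurePreserving.ae hn] with ω h
    change g.1 (n.1 (g.1.symm ω)) = ω
    rw [h, Equiv.apply_symm_apply]

/-- The group `Aut(Ω)` of invertible measure-preserving transformations of `(Ω, μ)`, up to equality
almost everywhere. -/
abbrev AutMeasure : Type z := measurePreservingPerms μ ⧸ aeTrivialPerms μ

/-- The action of an invertible measure-preserving transformation on `L⁰(Ω, X)`, given by
`(t r) ω = r (t⁻¹ ω)`. -/
def permAct {X : Type*} [TopologicalSpace X] :
    measurePreservingPerms μ →* Equiv.Perm (Ω →ₘ[μ] X) where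
  toFun t :=
    { toFun := fun r => r.compMeasurePreserving t.1.symm t.2.2
      invFun := fun r => r.compMeasurePreserving t.1 t.2.1
      left_inv := fun r => by
        induction r using AEEqFun.induction_on with
        | H f hf =>
          simp only [AEEqFun.compMeasurePreserving_mk, AEEqFun.mk_eq_mk, Function.comp_assoc]
          simp
      right_inv := fun r => by
        induction r using AEEqFun.induction_on with
        | H f hf =>
          simp only [AEEqFun.compMeasurePreserving_mk, AEEqFun.mk_eq_mk, Function.comp_assoc]
          simp }
  map_one' := by
    ext1 r
    exact AEEqFun.compMeasurePreserving_id r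
  map_mul' a b := by
    ext1 r
    exact AEEqFun.compMeasurePreserving_comp r b.2.2 a.2.2

theorem aeTrivialPerms_le_ker {X : Type*} [TopologicalSpace X] :
    aeTrivialPerms μ ≤ (permAct (X := X) μ).ker := by
  intro t ht
  refine MonoidHom.mem_ker.2 (Equiv.ext fun r => ?_)
  have h : (t.1.symm : Ω → Ω) =ᵐ[μ] id := (aeTrivialPerms μ).inv_mem ht
  exact (AEEqFun.compMeasurePreserving_congr r t.2.2 measurable_id h).trans
    (AEEqFun.compMeasurePreserving_id r)

/-- The action of `Aut(Ω)` on `L⁰(Ω, X)`. -/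
def autAct {X : Type*} [TopologicalSpace X] : AutMeasure μ →* Equiv.Perm (Ω →ₘ[μ] X) :=
  QuotientGroup.lift (aeTrivialPerms μ) (permAct μ) (aeTrivialPerms_le_ker μ)

/-- The topology of `Aut(Ω)`: pointwise convergence of the action on the metric space
`L⁰(Ω, [0, 1])`. -/
instance autMeasureTopology [IsProbabilityMeasure μ] : TopologicalSpace (AutMeasure μ) :=
  letI : MetricSpace (Ω →ₘ[μ] unitInterval) := integralMetric μ (isBoundedMetric_dist unitInterval)
  TopologicalSpace.induced
    (fun (t : AutMeasure μ) (R : Ω →ₘ[μ] unitInterval) => autAct μ t R) Pi.topologicalSpace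

/-- The action of `Aut(Ω)` by automorphisms on the group `L⁰(Ω, G)`. -/
def autActGroup (G : Type*) [TopologicalSpace G] [Group G] [IsTopologicalGroup G] :
    AutMeasure μ →* MulAut (Ω →ₘ[μ] G) where
  toFun t := MulEquiv.mk (autAct μ t) (by
    intro g h
    obtain ⟨t, rfl⟩ := QuotientGroup.mk_surjective t
    induction g using AEEqFun.induction_on with
    | H g hg =>
      induction h using AEEqFun.induction_on with
      | H h hh => rfl)
  map_one' := by
    ext1 r
    exact congrArg (fun σ : Equiv.Perm (Ω →ₘ[μ] G) => σ r) (map_one (autAct μ))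
  map_mul' a b := by
    ext1 r
    exact congrArg (fun σ : Equiv.Perm (Ω →ₘ[μ] G) => σ r) (map_mul (autAct μ) a b)

/-- The measurable wreath product `G ≀ Ω = L⁰(Ω, G) ⋊ Aut(Ω)`. -/
abbrev MeasurableWreath (G : Type*) [TopologicalSpace G] [Group G] [IsTopologicalGroup G] :=
  (Ω →ₘ[μ] G) ⋊[autActGroup μ G] AutMeasure μ

/-- The topology of the measurable wreath product is the product topology. -/
instance measurableWreathTopology [IsProbabilityMeasure μ] (G : Type*) [TopologicalSpace G]
    [Group G] [IsTopologicalGroup G] [TopologicalSpace.MetrizableSpace G] :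
    TopologicalSpace (MeasurableWreath μ G) :=
  letI : TopologicalSpace (Ω →ₘ[μ] G) := randomTopology μ G
  TopologicalSpace.induced (fun w : MeasurableWreath μ G => (w.left, w.right))
    instTopologicalSpaceProd

end Wreath

end MetricRandomization

end

open MetricRandomization

/-! An automorphism `σ` of the randomization is recovered sort by sort. On the auxiliary sort it is
an isometry commuting with `0`, `1 - x`, `x / 2` and truncated subtraction. It therefore fixes
constants and, after passing to limits, carries the indicator of `{R > q}` to that of `{σ R > q}`.
Applied to a Borel isomorphism from `Ω` to `[0, 1]`, this exhibits `σ` as composition with a point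
map, which preserves the measure because `σ` preserves expectation
(`IsAuxHom.exists_measurePreserving`). The same for `σ⁻¹` gives an almost everywhere inverse, and a
change on a null set yields an invertible transformation (`exists_measurePreservingPerm`), hence the
element `t` of `Aut(Ω)`.

Once `t` is known, compatibility with the symbols `⟦φ⟧` says that the value of any formula at `σ r`
at the point `ω` equals its value at `r` at `t⁻¹ ω` (`value_onMain`). For the constants `a i` of a
dense sequence of `M`, countability of the language allows one null set for all symbols. Off it, `a
i ↦ (σ (a i)) ω` preserves distances and atomic formulas and has dense image, so it extends to an
automorphism `g ω` (`exists_aut_of_dense`). A general `r` follows because a point of `M` is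
determined by its distances to a dense set (`exists_pointwiseAct_eq_onMain`).

Conversely, automorphisms of `M` preserve definable predicates, so every pair `(g, t)` acts by an
automorphism (`wreathHom`). Both directions are continuous because convergence of random variables
is detected on countably many test points (`tendsto_integral_dist`,
`tendsto_of_tendsto_pointwiseAct`). -/

namespace MetricRandomization

/-! ### Convergence in mean of random variables. -/

section Convergence

open Filter

variable {Ω : Type z} [MeasurableSpace Ω] {μ : Measure Ω} [IsProbabilityMeasure μ]

theorem tendsto_integral_zero_of_bounded {u : ℕ → Ω → ℝ} {C : ℝ}
    (hu : ∀ n, AEStronglyMeasurable (u n) μ) (hC : ∀ n ω, |u n ω| ≤ C)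
    (h : ∀ᵐ ω ∂μ, Tendsto (fun n => u n ω) atTop (𝓝 0)) :
    Tendsto (fun n => ∫ ω, u n ω ∂μ) atTop (𝓝 0) := by
  have := tendsto_integral_of_dominated_convergence (μ := μ) (F := u) (f := fun _ => (0 : ℝ))
    (fun _ => C) hu (integrable_const C) (fun n => Eventually.of_forall fun ω => hC n ω) h
  simpa using this

/-- If, along every sequence of indices, `u → 0` almost everywhere where `v → 0`, then `u` is
small in mean as soon as `v` is. -/
theorem exists_delta_of_seq {ι : Type*} {v u : ι → Ω → ℝ} {C : ℝ}
    (hv : ∀ i, Integrable (v i) μ) (hv0 : ∀ i ω, 0 ≤ v i ω)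
    (hu : ∀ i, AEStronglyMeasurable (u i) μ) (huC : ∀ i ω, |u i ω| ≤ C)
    (H : ∀ φ : ℕ → ι, ∀ᵐ ω ∂μ, Tendsto (fun n => v (φ n) ω) atTop (𝓝 0) →
      Tendsto (fun n => u (φ n) ω) atTop (𝓝 0)) {ε : ℝ} (hε : 0 < ε) :
    ∃ δ > 0, ∀ i, ∫ ω, v i ω ∂μ < δ → ∫ ω, u i ω ∂μ < ε := by
  by_contra! hcon
  choose φ h1 h2 using fun n : ℕ => hcon (1 / ((n : ℝ) + 1)) (by positivity)
  have hlim : Tendsto (fun n => ∫ ω, v (φ n) ω ∂μ) atTop (𝓝 0) :=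
    squeeze_zero (fun n => integral_nonneg (hv0 _)) (fun n => (h1 n).le)
      tendsto_one_div_add_atTop_nhds_zero_nat
  -- Convergence in mean gives convergence in measure, hence an almost everywhere convergent
  -- subsequence; only such sequences are covered by `H`.
  have hmeas : TendstoInMeasure μ (fun n => v (φ n)) atTop (fun _ => (0 : ℝ)) := by
    refine tendstoInMeasure_of_tendsto_eLpNorm one_ne_zero (fun n => (hv _).aestronglyMeasurable)
      aestronglyMeasurable_const ?_
    have e : ∀ n, eLpNorm (v (φ n) - fun _ => (0 : ℝ)) 1 μ
        = ENNReal.ofReal (∫ ω, v (φ n) ω ∂μ) := by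
      intro n
      rw [ofReal_integral_eq_lintegral_ofReal (hv _) (Eventually.of_forall (hv0 _)),
        eLpNorm_one_eq_lintegral_enorm]
      refine lintegral_congr fun ω => ?_
      simp [Real.enorm_of_nonneg (hv0 _ ω)]
    simp only [e]
    simpa using ENNReal.tendsto_ofReal hlim
  obtain ⟨ns, hns, hae⟩ := hmeas.exists_seq_tendsto_ae
  have hu' := tendsto_integral_zero_of_bounded (u := fun n => u (φ (ns n))) (fun n => hu _)
    (fun n => huC _) (by
      filter_upwards [hae, H fun n => φ (ns n)] with ω h3 h4 using h4 h3)
  exact absurd (ge_of_tendsto' hu' fun n => h2 (ns n)) (not_le.2 hε)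

/-- Convergence in `L⁰(Ω, M)` is detected by the distances to the points of a dense sequence. -/
theorem tendsto_integral_dist {ι : Type*} {l : Filter ι} {M : Type*} [MetricSpace M]
    [BoundedSpace M] {a : ℕ → M} (ha : DenseRange a) (f : ι → Ω →ₘ[μ] M) (r : Ω →ₘ[μ] M)
    (h : ∀ n, Tendsto (fun i => ∫ ω, |dist (f i ω) (a n) - dist (r ω) (a n)| ∂μ) l (𝓝 0)) :
    Tendsto (fun i => ∫ ω, dist (f i ω) (r ω) ∂μ) l (𝓝 0) := by
  obtain ⟨C, hC⟩ := (isBoundedMetric_dist M).bounded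
  have meas : ∀ (s : Ω →ₘ[μ] M) n, AEStronglyMeasurable (fun ω => dist (s ω) (a n)) μ :=
    fun s n => s.aestronglyMeasurable.dist aestronglyMeasurable_const
  -- The distance from `r ω` to the first `N + 1` points of the dense sequence; it tends to `0` at
  -- every `ω`, so its mean does too.
  let m : ℕ → Ω → ℝ := fun N ω =>
    (Finset.range (N + 1)).inf' Finset.nonempty_range_add_one fun n => dist (r ω) (a n)
  have m_nonneg : ∀ N ω, 0 ≤ m N ω := fun N ω => Finset.le_inf' _ _ fun n _ => dist_nonneg
  have m_le : ∀ N ω, ∀ n ≤ N, m N ω ≤ dist (r ω) (a n) := fun N ω n hn =>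
    Finset.inf'_le _ (Finset.mem_range.2 (by omega))
  have m_bdd : ∀ N ω, |m N ω| ≤ C := fun N ω => by
    rw [abs_of_nonneg (m_nonneg N ω)]
    exact (m_le N ω 0 (by omega)).trans (hC _ _)
  have m_meas : ∀ N, AEStronglyMeasurable (m N) μ := by
    intro N
    have : ∀ s : Finset ℕ, ∀ hs : s.Nonempty,
        AEStronglyMeasurable (fun ω => s.inf' hs fun n => dist (r ω) (a n)) μ := by
      intro s hs
      induction hs using Finset.Nonempty.cons_induction with
      | singleton n => simpa using meas r n
      | cons n s hn hs ih =>
        simp only [Finset.inf'_cons hs]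
        exact (meas r n).inf ih
    exact this _ _
  have m_lim : Tendsto (fun N => ∫ ω, m N ω ∂μ) atTop (𝓝 0) := by
    refine tendsto_integral_zero_of_bounded m_meas m_bdd (Eventually.of_forall fun ω => ?_)
    refine Metric.tendsto_atTop.2 fun ε hε => ?_
    obtain ⟨n, hn⟩ := ha.exists_dist_lt (r ω) hε
    refine ⟨n, fun N hN => ?_⟩
    rw [Real.dist_0_eq_abs, abs_of_nonneg (m_nonneg N ω)]
    exact (m_le N ω n hN).trans_lt hn
  have int_abs : ∀ i n, Integrable (fun ω => |dist (f i ω) (a n) - dist (r ω) (a n)|) μ := by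
    intro i n
    refine Integrable.of_bound (C := C) ((meas _ n).sub (meas _ n)).norm
      (Eventually.of_forall fun ω => ?_)
    rw [Real.norm_eq_abs, abs_abs]
    exact (abs_dist_sub_le _ _ _).trans (hC _ _)
  have int_m : ∀ N, Integrable (m N) μ := fun N =>
    Integrable.of_bound (C := C) (m_meas N) (Eventually.of_forall fun ω => m_bdd N ω)
  -- At each `ω`, use the triangle inequality through the `a n` attaining the minimum `m N ω`. The
  -- index depends on `ω`, so its term is bounded by the whole sum.
  have bound : ∀ i N, ∫ ω, dist (f i ω) (r ω) ∂μ ≤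
      ∑ n ∈ Finset.range (N + 1), ∫ ω, |dist (f i ω) (a n) - dist (r ω) (a n)| ∂μ
        + 2 * ∫ ω, m N ω ∂μ := by
    intro i N
    rw [← integral_finsetSum _ fun n _ => int_abs i n, ← integral_const_mul,
      ← integral_add (integrable_finsetSum _ fun n _ => int_abs i n) ((int_m N).const_mul 2)]
    refine integral_mono ((isBoundedMetric_dist M).integrable (f i) r)
      ((integrable_finsetSum _ fun n _ => int_abs i n).add ((int_m N).const_mul 2)) fun ω => ?_
    obtain ⟨n, hn, e⟩ := Finset.exists_mem_eq_inf' (s := Finset.range (N + 1))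
      Finset.nonempty_range_add_one fun n => dist (r ω) (a n)
    have e' : m N ω = dist (r ω) (a n) := e
    have h1 := Finset.single_le_sum (f := fun n => |dist (f i ω) (a n) - dist (r ω) (a n)|)
      (fun _ _ => abs_nonneg _) hn
    have h2 := dist_triangle_right (f i ω) (r ω) (a n)
    have h3 := le_abs_self (dist (f i ω) (a n) - dist (r ω) (a n))
    simp only at h1 ⊢
    rw [e']
    linarith
  refine Metric.tendsto_nhds.2 fun ε hε => ?_
  obtain ⟨N, hN⟩ := (m_lim.eventually (gt_mem_nhds (show (0 : ℝ) < ε / 4 by positivity))).exists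
  have hsum : Tendsto (fun i => ∑ n ∈ Finset.range (N + 1),
      ∫ ω, |dist (f i ω) (a n) - dist (r ω) (a n)| ∂μ) l (𝓝 0) := by
    simpa using tendsto_finsetSum (Finset.range (N + 1)) fun n _ => h n
  filter_upwards [hsum.eventually (gt_mem_nhds (show (0 : ℝ) < ε / 2 by positivity))] with i hi
  rw [Real.dist_0_eq_abs, abs_of_nonneg (integral_nonneg fun ω => dist_nonneg)]
  linarith [bound i N]

end Convergence

/-! ### Correcting an almost invertible map to an invertible one. -/

section PointRealization

variable {Ω : Type z} [MeasurableSpace Ω] (μ : Measure Ω)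

theorem not_countable_of_nullSingletonClass [NeZero μ] [NullSingletonClass μ] : ¬ Countable Ω :=
  fun _ => NeZero.ne μ (Measure.measure_univ_eq_zero.1 (Set.countable_univ.measure_zero μ))

/-- Transport `Ω` to the plane: of the uncountably many disjoint vertical lines, only countably many
have positive measure, and each line is uncountable. -/
theorem exists_uncountable_null [StandardBorelSpace Ω] [IsProbabilityMeasure μ] [NullSingletonClass μ] :
    ∃ N : Set Ω, MeasurableSet N ∧ μ N = 0 ∧ ¬ N.Countable := by
  have hR : ¬ Countable ℝ := not_countable
  have hRR : ¬ Countable (ℝ × ℝ) := not_countable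
  let e : Ω ≃ᵐ ℝ × ℝ :=
    PolishSpace.measurableEquivOfNotCountable (not_countable_of_nullSingletonClass μ) hRR
  let p : Ω → ℝ := fun ω => (e ω).1
  have hp : Measurable p := measurable_fst.comp e.measurable
  have hc : Set.Countable {x : ℝ | 0 < μ {ω | p ω = x}} := Measure.countable_meas_level_set_pos hp
  obtain ⟨x, hx⟩ : ∃ x : ℝ, ¬ 0 < μ {ω | p ω = x} := by
    by_contra! h
    exact hR (Set.countable_univ_iff.1 (hc.mono fun x _ => h x))
  refine ⟨{ω | p ω = x}, hp (measurableSet_singleton x), le_antisymm (not_lt.1 hx) zero_le, ?_⟩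
  intro hN
  have := hN.to_subtype
  exact hR (Function.Injective.countable (β := {ω | p ω = x})
    (f := fun y => ⟨e.symm (x, y), by simp [p]⟩)
    fun y z h => by simpa using h)

/-- A measure-preserving map with a measure-preserving left inverse almost everywhere agrees almost
everywhere with an invertible measure-preserving transformation. -/
theorem exists_measurePreservingPerm [StandardBorelSpace Ω] [IsProbabilityMeasure μ] [NullSingletonClass μ] {T S : Ω → Ω}
    (hT : MeasurePreserving T μ μ) (hS : MeasurePreserving S μ μ)
    (hST : ∀ᵐ ω ∂μ, S (T ω) = ω) :
    ∃ t : measurePreservingPerms μ, t.1.symm =ᵐ[μ] T := by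
  obtain ⟨N, hNm, hN0, hNc⟩ := exists_uncountable_null μ
  have hN : ∀ᵐ ω ∂μ, ω ∉ N := measure_eq_zero_iff_ae_notMem.1 hN0
  -- `T` and `S` are mutually inverse between `A` and `B`. Both sets avoid `N`, so their complements
  -- are uncountable standard Borel spaces and hence Borel isomorphic; gluing such an isomorphism to
  -- `T` gives a bijection of `Ω`.
  let A : Set Ω := {ω | S (T ω) = ω} ∩ (Nᶜ ∩ T ⁻¹' Nᶜ)
  let B : Set Ω := {ω | T (S ω) = ω} ∩ (Nᶜ ∩ S ⁻¹' Nᶜ)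
  have hA : MeasurableSet A :=
    (measurableSet_eq_fun (hS.measurable.comp hT.measurable) measurable_id).inter
      (hNm.compl.inter (hT.measurable hNm.compl))
  have hB : MeasurableSet B :=
    (measurableSet_eq_fun (hT.measurable.comp hS.measurable) measurable_id).inter
      (hNm.compl.inter (hS.measurable hNm.compl))
  have hAae : ∀ᵐ ω ∂μ, ω ∈ A := by
    filter_upwards [hST, hN, hT.quasiMeasurePreserving.ae hN] with ω h1 h2 h3 using ⟨h1, h2, h3⟩
  have hAB : ∀ ω ∈ A, T ω ∈ B := fun ω ⟨h1, h2, h3⟩ => by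
    have h1' : S (T ω) = ω := h1
    exact ⟨by simp [h1'], h3, by simpa [h1'] using h2⟩
  have hBA : ∀ ω ∈ B, S ω ∈ A := fun ω ⟨h1, h2, h3⟩ => by
    have h1' : T (S ω) = ω := h1
    exact ⟨by simp [h1'], h3, by simpa [h1'] using h2⟩
  let eAB : A ≃ᵐ B :=
    { toFun := fun x => ⟨T x, hAB x x.2⟩
      invFun := fun y => ⟨S y, hBA y y.2⟩
      left_inv := fun x => Subtype.ext x.2.1
      right_inv := fun y => Subtype.ext y.2.1
      measurable_toFun := (hT.measurable.comp measurable_subtype_coe).subtype_mk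
      measurable_invFun := (hS.measurable.comp measurable_subtype_coe).subtype_mk }
  have hAc : ¬ Countable ↥Aᶜ := fun h =>
    hNc ((Set.countable_coe_iff.1 h).mono fun x (hx : x ∈ N) (hxA : x ∈ A) => hxA.2.1 hx)
  have hBc : ¬ Countable ↥Bᶜ := fun h =>
    hNc ((Set.countable_coe_iff.1 h).mono fun x (hx : x ∈ N) (hxB : x ∈ B) => hxB.2.1 hx)
  have : StandardBorelSpace ↥Aᶜ := hA.compl.standardBorel
  have : StandardBorelSpace ↥Bᶜ := hB.compl.standardBorel
  let eC : ↥Aᶜ ≃ᵐ ↥Bᶜ := PolishSpace.measurableEquivOfNotCountable hAc hBc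
  classical
  let s : Ω ≃ᵐ Ω := ((MeasurableEquiv.sumCompl hA).symm.trans
    (MeasurableEquiv.sumCongr eAB eC)).trans (MeasurableEquiv.sumCompl hB)
  have hs : ∀ ω ∈ A, s ω = T ω := by
    intro ω hω
    change (Equiv.Set.sumCompl B) ((Equiv.sumCongr eAB.toEquiv eC.toEquiv)
      ((Equiv.Set.sumCompl A).symm ω)) = T ω
    rw [Equiv.Set.sumCompl_symm_apply_of_mem hω]
    rfl
  have hs' : s =ᵐ[μ] T := hAae.mono hs
  have hsp : MeasurePreserving s μ μ :=
    ⟨s.measurable, (Measure.map_congr hs').trans hT.map_eq⟩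
  -- The inverse is taken because transformations act on random variables through `t⁻¹`.
  exact ⟨⟨s.symm.toEquiv, hsp.symm, hsp⟩, hs'⟩

end PointRealization

/-! ### Endomorphisms of the auxiliary sort come from point maps. -/

section Auxiliary

open Filter

variable {Ω : Type z} [MeasurableSpace Ω] {μ : Measure Ω}

/-- The maps of the auxiliary sort of a randomization to itself that respect its structure. -/
structure IsAuxHom (F : (Ω →ₘ[μ] unitInterval) → (Ω →ₘ[μ] unitInterval)) : Prop where
  isometry : ∀ R S, ∫ ω, dist (F R ω) (F S ω) ∂μ = ∫ ω, dist (R ω) (S ω) ∂μ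
  zero : F (AEEqFun.const Ω 0) = AEEqFun.const Ω 0
  neg : ∀ R, F (AEEqFun.comp unitInterval.symm unitInterval.continuous_symm R) =
    AEEqFun.comp unitInterval.symm unitInterval.continuous_symm (F R)
  half : ∀ R, F (AEEqFun.comp unitHalf continuous_unitHalf R) =
    AEEqFun.comp unitHalf continuous_unitHalf (F R)
  monus : ∀ R S, F (AEEqFun.comp₂ unitMonus continuous_unitMonus R S) =
    AEEqFun.comp₂ unitMonus continuous_unitMonus (F R) (F S)
  expectation : ∀ R, ∫ ω, (F R ω : ℝ) ∂μ = ∫ ω, (R ω : ℝ) ∂μ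

/-- Truncated doubling `min (2 x) 1` on `[0, 1]`. -/
def unitDouble (x : unitInterval) : unitInterval :=
  unitInterval.symm (unitMonus (unitInterval.symm x) x)

theorem continuous_unitDouble : Continuous unitDouble :=
  unitInterval.continuous_symm.comp
    (continuous_unitMonus.comp (unitInterval.continuous_symm.prodMk continuous_id))

theorem coe_unitDouble (x : unitInterval) : (unitDouble x : ℝ) = min (2 * (x : ℝ)) 1 := by
  simp only [unitDouble, unitMonus, unitInterval.coe_symm_eq]
  rw [min_def, max_def]
  split_ifs <;> linarith

theorem coe_unitDouble_iterate (x : unitInterval) (n : ℕ) :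
    (unitDouble^[n] x : ℝ) = min (2 ^ n * (x : ℝ)) 1 := by
  induction n with
  | zero => simp [x.2.2]
  | succ n ih =>
    rw [Function.iterate_succ_apply', coe_unitDouble, ih, pow_succ]
    rw [min_def, min_def, min_def]
    split_ifs <;> linarith

/-- A positive number reaches `1` after finitely many truncated doublings, while `0` stays put. This
makes indicator functions limits of terms in the operations of the auxiliary sort. -/
theorem tendsto_unitDouble_iterate (x : unitInterval) :
    Tendsto (fun n => unitDouble^[n] x) atTop (𝓝 (if 0 < x then 1 else 0)) := by
  split_ifs with h
  · have h' : (0 : ℝ) < x := h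
    obtain ⟨N, hN⟩ := pow_unbounded_of_one_lt (1 / (x : ℝ)) one_lt_two
    refine tendsto_const_nhds.congr' ?_
    filter_upwards [eventually_ge_atTop N] with n hn
    refine Subtype.ext ?_
    rw [coe_unitDouble_iterate, min_eq_right]
    · rfl
    · rw [← div_le_iff₀ h']
      exact hN.le.trans (pow_le_pow_right₀ one_le_two hn)
  · have h' : x = 0 := le_antisymm (not_lt.1 h) bot_le
    subst h'
    refine tendsto_const_nhds.congr fun n => Subtype.ext ?_
    rw [coe_unitDouble_iterate]
    simp

/-- The random variable which is the indicator function of an event. -/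
noncomputable def eventIndicator (μ : Measure Ω) {A : Set Ω} (hA : MeasurableSet A) :
    Ω →ₘ[μ] unitInterval :=
  AEEqFun.mk (A.indicator 1) (stronglyMeasurable_one.indicator hA).aestronglyMeasurable

theorem coeFn_eventIndicator {A : Set Ω} (hA : MeasurableSet A) :
    eventIndicator μ hA =ᵐ[μ] A.indicator 1 :=
  AEEqFun.coeFn_mk _ _

theorem integral_eventIndicator [IsProbabilityMeasure μ] {A : Set Ω} (hA : MeasurableSet A) :
    ∫ ω, (eventIndicator μ hA ω : ℝ) ∂μ = μ.real A := by
  rw [← integral_indicator_one hA]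
  refine integral_congr_ae ?_
  filter_upwards [coeFn_eventIndicator (μ := μ) hA] with ω h
  rw [h]
  by_cases hω : ω ∈ A <;> simp [hω]

theorem eventIndicator_congr {A B : Set Ω} (hA : MeasurableSet A) (hB : MeasurableSet B)
    (h : A = B) : eventIndicator μ hA = eventIndicator μ hB := by
  subst h; rfl

theorem eventIndicator_eq_iff {A B : Set Ω} (hA : MeasurableSet A) (hB : MeasurableSet B) :
    eventIndicator μ hA = eventIndicator μ hB ↔ ∀ᵐ ω ∂μ, ω ∈ A ↔ ω ∈ B := by
  rw [eventIndicator, eventIndicator, AEEqFun.mk_eq_mk]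
  refine eventually_congr (Eventually.of_forall fun ω => ?_)
  by_cases h1 : ω ∈ A <;> by_cases h2 : ω ∈ B <;> simp [h1, h2]

namespace IsAuxHom

variable [IsProbabilityMeasure μ] {F : (Ω →ₘ[μ] unitInterval) → (Ω →ₘ[μ] unitInterval)}
  (hF : IsAuxHom F)

include hF

/-- By boundedness, almost everywhere convergence implies convergence in the metric, for which `F`
is isometric and limits are unique. -/
theorem eq_of_tendsto {R : ℕ → Ω →ₘ[μ] unitInterval} {R' S : Ω →ₘ[μ] unitInterval}
    (h1 : ∀ᵐ ω ∂μ, Tendsto (fun n => R n ω) atTop (𝓝 (R' ω)))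
    (h2 : ∀ᵐ ω ∂μ, Tendsto (fun n => F (R n) ω) atTop (𝓝 (S ω))) : F R' = S := by
  have key : ∀ (Q : ℕ → Ω →ₘ[μ] unitInterval) (Q' : Ω →ₘ[μ] unitInterval),
      (∀ᵐ ω ∂μ, Tendsto (fun n => Q n ω) atTop (𝓝 (Q' ω))) →
      Tendsto (fun n => ∫ ω, dist (Q n ω) (Q' ω) ∂μ) atTop (𝓝 0) := by
    intro Q Q' h
    obtain ⟨C, hC⟩ := (isBoundedMetric_dist unitInterval).bounded
    refine tendsto_integral_zero_of_bounded (C := C)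
      (fun n => ((isBoundedMetric_dist unitInterval).integrable _ _).aestronglyMeasurable)
      (fun n ω => ?_) ?_
    · rw [abs_of_nonneg dist_nonneg]
      exact hC _ _
    · filter_upwards [h] with ω hω using tendsto_iff_dist_tendsto_zero.1 hω
  let : MetricSpace (Ω →ₘ[μ] unitInterval) := integralMetric μ (isBoundedMetric_dist unitInterval)
  refine tendsto_nhds_unique (f := fun n => F (R n)) (l := atTop) ?_ ?_
  · refine tendsto_iff_dist_tendsto_zero.2 ?_
    exact (key R R' h1).congr fun n => (hF.isometry _ _).symm
  · exact tendsto_iff_dist_tendsto_zero.2 (key _ S h2)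

/-- The numbers obtained from `0` by halving and `x ↦ 1 - x` are dense in `[0, 1]`, and the
corresponding constants are fixed. -/
theorem const (q : unitInterval) : F (AEEqFun.const Ω q) = AEEqFun.const Ω q := by
  have key : ∀ (n : ℕ) (x : unitInterval), ∃ s : unitInterval,
      F (AEEqFun.const Ω s) = AEEqFun.const Ω s ∧ |(s : ℝ) - x| ≤ (1 / 2) ^ n := by
    intro n
    induction n with
    | zero =>
      refine fun x => ⟨0, hF.zero, ?_⟩
      simpa [abs_of_nonneg x.2.1] using x.2.2
    | succ n ih =>
      have hh : ∀ s, F (AEEqFun.const Ω s) = AEEqFun.const Ω s →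
          F (AEEqFun.const Ω (unitHalf s)) = AEEqFun.const Ω (unitHalf s) := by
        intro s hs
        have := hF.half (AEEqFun.const Ω s)
        rwa [hs] at this
      have hn : ∀ s, F (AEEqFun.const Ω s) = AEEqFun.const Ω s →
          F (AEEqFun.const Ω (unitInterval.symm s)) = AEEqFun.const Ω (unitInterval.symm s) := by
        intro s hs
        have := hF.neg (AEEqFun.const Ω s)
        rwa [hs] at this
      -- Approximate `2 * x` and halve, which also halves the error; points above `1 / 2` are then
      -- handled by reflection.
      have low : ∀ x : unitInterval, (x : ℝ) ≤ 1 / 2 → ∃ s : unitInterval,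
          F (AEEqFun.const Ω s) = AEEqFun.const Ω s ∧ |(s : ℝ) - x| ≤ (1 / 2) ^ (n + 1) := by
        intro x hx
        obtain ⟨s, hs, hsx⟩ := ih ⟨2 * x, by linarith [x.2.1], by linarith⟩
        refine ⟨unitHalf s, hh s hs, ?_⟩
        have e : ((unitHalf s : unitInterval) : ℝ) - x = ((s : ℝ) - 2 * x) / 2 := by
          simp only [unitHalf]; ring
        rw [e, abs_div, pow_succ, abs_of_pos (two_pos (α := ℝ))]
        linarith
      intro x
      rcases le_total (x : ℝ) (1 / 2) with hx | hx
      · exact low x hx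
      · obtain ⟨s, hs, hsx⟩ := low (unitInterval.symm x) (by
          rw [unitInterval.coe_symm_eq]; linarith)
        refine ⟨unitInterval.symm s, hn s hs, ?_⟩
        rw [unitInterval.coe_symm_eq] at hsx ⊢
        rwa [show (1 - (s : ℝ) - x) = -(s - (1 - x)) by ring, abs_neg]
  choose s hs hsq using fun n => key n q
  have hlim : Tendsto s atTop (𝓝 q) := by
    refine tendsto_iff_dist_tendsto_zero.2 (squeeze_zero (fun _ => dist_nonneg) hsq ?_)
    exact tendsto_pow_atTop_nhds_zero_of_lt_one (by norm_num) (by norm_num)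
  have h1 : ∀ᵐ ω ∂μ, Tendsto (fun n => (AEEqFun.const Ω (s n) : Ω →ₘ[μ] unitInterval) ω) atTop
      (𝓝 ((AEEqFun.const Ω q : Ω →ₘ[μ] unitInterval) ω)) := by
    filter_upwards [ae_all_iff.2 fun n => AEEqFun.coeFn_const Ω (s n) (μ := μ),
      AEEqFun.coeFn_const Ω q (μ := μ)] with ω h1 h2
    simpa only [h1, h2, Function.const_apply] using hlim
  exact hF.eq_of_tendsto h1 (by simpa only [hs] using h1)

omit [IsProbabilityMeasure μ] in
theorem unitDouble_comp (R : Ω →ₘ[μ] unitInterval) :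
    F (AEEqFun.comp unitDouble continuous_unitDouble R) =
      AEEqFun.comp unitDouble continuous_unitDouble (F R) := by
  have e : ∀ R : Ω →ₘ[μ] unitInterval, AEEqFun.comp unitDouble continuous_unitDouble R =
      AEEqFun.comp unitInterval.symm unitInterval.continuous_symm
        (AEEqFun.comp₂ unitMonus continuous_unitMonus
          (AEEqFun.comp unitInterval.symm unitInterval.continuous_symm R) R) := by
    intro R
    induction R using AEEqFun.induction_on with
    | H f hf => rfl
  rw [e, e, hF.neg, hF.monus, hF.neg]

theorem iterate_comp (q : unitInterval) (R : Ω →ₘ[μ] unitInterval) (n : ℕ) :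
    ∃ Q : Ω →ₘ[μ] unitInterval, (∀ᵐ ω ∂μ, Q ω = unitDouble^[n] (unitMonus (R ω) q)) ∧
      ∀ᵐ ω ∂μ, F Q ω = unitDouble^[n] (unitMonus (F R ω) q) := by
  induction n with
  | zero =>
    refine ⟨AEEqFun.comp₂ unitMonus continuous_unitMonus R (AEEqFun.const Ω q), ?_, ?_⟩
    · filter_upwards [AEEqFun.coeFn_comp₂ unitMonus continuous_unitMonus R (AEEqFun.const Ω q),
        AEEqFun.coeFn_const Ω q (μ := μ)] with ω h1 h2
      simp [h1, h2]
    · rw [hF.monus, hF.const]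
      filter_upwards [AEEqFun.coeFn_comp₂ unitMonus continuous_unitMonus (F R) (AEEqFun.const Ω q),
        AEEqFun.coeFn_const Ω q (μ := μ)] with ω h1 h2
      simp [h1, h2]
  | succ n ih =>
    obtain ⟨Q, h1, h2⟩ := ih
    refine ⟨AEEqFun.comp unitDouble continuous_unitDouble Q, ?_, ?_⟩
    · filter_upwards [h1, AEEqFun.coeFn_comp unitDouble continuous_unitDouble Q] with ω h3 h4
      rw [h4, Function.comp_apply, h3, Function.iterate_succ_apply']
    · rw [hF.unitDouble_comp]
      filter_upwards [h2, AEEqFun.coeFn_comp unitDouble continuous_unitDouble (F Q)] with ω h3 h4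
      rw [h4, Function.comp_apply, h3, Function.iterate_succ_apply']

/-- The indicator of `{R > q}` is the limit of the truncated doublings of `max (R - q) 0`, and `F`
commutes with each of them and with the limit. -/
theorem superlevel (q : unitInterval) (R : Ω →ₘ[μ] unitInterval) :
    F (eventIndicator μ (measurableSet_lt (measurable_const (a := q)) R.measurable)) =
      eventIndicator μ (measurableSet_lt (measurable_const (a := q)) (F R).measurable) := by
  choose Q h1 h2 using hF.iterate_comp q R
  have hpos : ∀ x : unitInterval, 0 < unitMonus x q ↔ q < x := by
    intro x
    rw [← Subtype.coe_lt_coe, ← Subtype.coe_lt_coe]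
    simp [unitMonus]
  have hlim : ∀ x : unitInterval, Tendsto (fun n => unitDouble^[n] (unitMonus x q)) atTop
      (𝓝 (if q < x then 1 else 0)) := by
    intro x
    simpa only [hpos] using tendsto_unitDouble_iterate (unitMonus x q)
  refine hF.eq_of_tendsto (R := Q) ?_ ?_
  · filter_upwards [ae_all_iff.2 h1, coeFn_eventIndicator (μ := μ)
      (measurableSet_lt (measurable_const (a := q)) R.measurable)] with ω h3 h4
    simpa only [h3, h4, Set.indicator_apply, Set.mem_ofPred_eq, Pi.one_apply] using hlim (R ω)
  · filter_upwards [ae_all_iff.2 h2, coeFn_eventIndicator (μ := μ)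
      (measurableSet_lt (measurable_const (a := q)) (F R).measurable)] with ω h3 h4
    simpa only [h3, h4, Set.indicator_apply, Set.mem_ofPred_eq, Pi.one_apply] using hlim (F R ω)

omit [IsProbabilityMeasure μ] in
theorem eventIndicator_compl {A B : Set Ω} (hA : MeasurableSet A) (hB : MeasurableSet B)
    (h : F (eventIndicator μ hA) = eventIndicator μ hB) :
    F (eventIndicator μ hA.compl) = eventIndicator μ hB.compl := by
  have e : ∀ {A : Set Ω} (hA : MeasurableSet A), eventIndicator μ hA.compl =
      AEEqFun.comp unitInterval.symm unitInterval.continuous_symm (eventIndicator μ hA) := by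
    intro A hA
    refine (AEEqFun.mk_eq_mk.2 (Eventually.of_forall fun ω => ?_)).trans
      (AEEqFun.comp_mk unitInterval.symm _ _ _).symm
    by_cases hω : ω ∈ A <;> simp [hω]
  rw [e hA, e hB, hF.neg, h]

omit [IsProbabilityMeasure μ] in
theorem eventIndicator_diff {A B A' B' : Set Ω} (hA : MeasurableSet A) (hB : MeasurableSet B)
    (hA' : MeasurableSet A') (hB' : MeasurableSet B')
    (h : F (eventIndicator μ hA) = eventIndicator μ hB)
    (h' : F (eventIndicator μ hA') = eventIndicator μ hB') :
    F (eventIndicator μ (hA.diff hA')) = eventIndicator μ (hB.diff hB') := by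
  have e : ∀ {A A' : Set Ω} (hA : MeasurableSet A) (hA' : MeasurableSet A'),
      eventIndicator μ (hA.diff hA') = AEEqFun.comp₂ unitMonus continuous_unitMonus
        (eventIndicator μ hA) (eventIndicator μ hA') := by
    intro A A' hA hA'
    refine (AEEqFun.mk_eq_mk.2 (Eventually.of_forall fun ω => ?_)).trans
      (AEEqFun.comp₂_mk_mk unitMonus _ _ _ _ _).symm
    by_cases hω : ω ∈ A <;> by_cases hω' : ω ∈ A' <;>
      simp [hω, hω', unitMonus]
  rw [e hA hA', e hB hB', hF.monus, h, h']

/-- Finite unions are expressed by complements and differences, and a countable union is the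
increasing limit of finite ones. -/
theorem eventIndicator_iUnion {A B : ℕ → Set Ω} (hA : ∀ n, MeasurableSet (A n))
    (hB : ∀ n, MeasurableSet (B n))
    (h : ∀ n, F (eventIndicator μ (hA n)) = eventIndicator μ (hB n)) :
    F (eventIndicator μ (MeasurableSet.iUnion hA)) =
      eventIndicator μ (MeasurableSet.iUnion hB) := by
  have mA : ∀ {A : ℕ → Set Ω}, (∀ n, MeasurableSet (A n)) → ∀ n,
      MeasurableSet (Set.accumulate A n) := fun hA n =>
    MeasurableSet.biUnion (Set.to_countable _) fun k _ => hA k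
  have key : ∀ n, F (eventIndicator μ (mA hA n)) = eventIndicator μ (mA hB n) := by
    intro n
    induction n with
    | zero =>
      rw [eventIndicator_congr (mA hA 0) (hA 0) (Set.accumulate_zero_nat A),
        eventIndicator_congr (mA hB 0) (hB 0) (Set.accumulate_zero_nat B), h]
    | succ n ih =>
      have e : ∀ (A : ℕ → Set Ω), Set.accumulate A (n + 1) =
          ((Set.accumulate A n)ᶜ \ A (n + 1))ᶜ := by
        intro A
        rw [Set.accumulate_succ]
        ext ω
        simp only [Set.mem_union, Set.mem_compl_iff, Set.mem_sdiff]
        tauto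
      rw [eventIndicator_congr _ ((mA hA n).compl.diff (hA (n + 1))).compl (e A),
        eventIndicator_congr _ ((mA hB n).compl.diff (hB (n + 1))).compl (e B)]
      exact hF.eventIndicator_compl _ _ (hF.eventIndicator_diff _ _ _ _
        (hF.eventIndicator_compl _ _ ih) (h (n + 1)))
  have lim : ∀ {A : ℕ → Set Ω} (hA : ∀ n, MeasurableSet (A n)), ∀ᵐ ω ∂μ,
      Tendsto (fun n => eventIndicator μ (mA hA n) ω) atTop
        (𝓝 (eventIndicator μ (MeasurableSet.iUnion hA) ω)) := by
    intro A hA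
    filter_upwards [ae_all_iff.2 fun n => coeFn_eventIndicator (μ := μ) (mA hA n),
      coeFn_eventIndicator (μ := μ) (MeasurableSet.iUnion hA)] with ω h1 h2
    simp only [h1, h2]
    rw [← Set.iUnion_accumulate]
    exact (Set.monotone_accumulate.tendsto_indicator _ 1 ω).mono_right (pure_le_nhds _)
  refine hF.eq_of_tendsto (lim hA) ?_
  simpa only [key] using lim hB

/-- Every map that respects the structure of the auxiliary sort is the composition with a
measure-preserving map. -/
theorem exists_measurePreserving [StandardBorelSpace Ω] [NullSingletonClass μ] :
    ∃ T : Ω → Ω, MeasurePreserving T μ μ ∧ ∀ R, F R =ᵐ[μ] fun ω => R (T ω) := by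
  have hI : ¬ Countable unitInterval := not_countable_of_nullSingletonClass volume
  let h : Ω ≃ᵐ unitInterval :=
    PolishSpace.measurableEquivOfNotCountable (not_countable_of_nullSingletonClass μ) hI
  -- A Borel isomorphism is a universal random variable: every event is a preimage under `h`, so `F
  -- H` determines `F` on all indicators. The point map must then be `h⁻¹ ∘ F H`.
  let H : Ω →ₘ[μ] unitInterval := AEEqFun.mk h h.measurable.aestronglyMeasurable
  have hH : H =ᵐ[μ] h := AEEqFun.coeFn_mk _ _
  have hm : Measurable (F H) := (F H).measurable
  have key : ∀ (A : Set unitInterval) (hA : MeasurableSet A),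
      F (eventIndicator μ (h.measurable hA)) = eventIndicator μ (hm hA) := by
    -- The half-lines form a generating π-system, handled by `superlevel`; complements and disjoint
    -- unions extend the identity to all Borel sets.
    refine MeasurableSpace.induction_on_inter
      (BorelSpace.measurable_eq.trans (borel_eq_generateFrom_Ioi unitInterval)) isPiSystem_Ioi
      ?_ ?_ ?_ ?_
    · have e : eventIndicator μ (A := (∅ : Set Ω)) MeasurableSet.empty = AEEqFun.const Ω 0 :=
        AEEqFun.mk_eq_mk.2 (Eventually.of_forall fun ω => by simp)
      exact (congrArg F e).trans (hF.zero.trans e.symm)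
    · rintro _ ⟨q, rfl⟩
      refine Eq.trans (congrArg F ?_) (hF.superlevel q H)
      refine (eventIndicator_eq_iff _ _).2 ?_
      filter_upwards [hH] with ω hω
      change q < h ω ↔ q < H ω
      rw [hω]
    · exact fun A hA hA' => hF.eventIndicator_compl (h.measurable hA) (hm hA) hA'
    · intro A _ hA hA'
      have := hF.eventIndicator_iUnion (fun n => h.measurable (hA n)) (fun n => hm (hA n)) hA'
      rw [eventIndicator_congr _ (MeasurableSet.iUnion fun n => h.measurable (hA n))
        Set.preimage_iUnion, this]
      exact eventIndicator_congr _ _ Set.preimage_iUnion.symm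
  let T : Ω → Ω := h.symm ∘ F H
  have hTm : Measurable T := h.symm.measurable.comp hm
  have ind : ∀ {B : Set Ω} (hB : MeasurableSet B),
      F (eventIndicator μ hB) = eventIndicator μ (hTm hB) := by
    intro B hB
    refine Eq.trans (congrArg F (eventIndicator_congr _ _ ?_))
      (key (h.symm ⁻¹' B) (h.symm.measurable hB))
    ext ω
    simp
  refine ⟨T, ⟨hTm, ?_⟩, fun R => ?_⟩
  · ext B hB
    rw [Measure.map_apply hTm hB]
    have e := hF.expectation (eventIndicator μ hB)
    rw [ind, integral_eventIndicator, integral_eventIndicator] at e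
    exact (measureReal_eq_measureReal_iff).1 e
  · obtain ⟨D, hDc, hD⟩ := TopologicalSpace.exists_countable_dense unitInterval
    have := hDc.to_subtype
    -- Two numbers lying above the same elements of a dense set coincide; countability of `D` leaves
    -- a single null set.
    have hae : ∀ᵐ ω ∂μ, ∀ q : D, (q : unitInterval) < F R ω ↔ (q : unitInterval) < R (T ω) := by
      refine ae_all_iff.2 fun q => ?_
      have e := (hF.superlevel q R).symm.trans (ind _)
      exact (eventIndicator_eq_iff _ _).1 e
    filter_upwards [hae] with ω hω
    refine le_antisymm (le_of_not_gt fun hlt => ?_) (le_of_not_gt fun hlt => ?_)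
    · obtain ⟨q, hq, h1, h2⟩ := hD.exists_between hlt
      exact lt_asymm ((hω ⟨q, hq⟩).1 h2) h1
    · obtain ⟨q, hq, h1, h2⟩ := hD.exists_between hlt
      exact lt_asymm ((hω ⟨q, hq⟩).2 h2) h1

end IsAuxHom

end Auxiliary

/-! ### Automorphisms of `M` preserve definable predicates. -/

section Invariance

variable {L : FirstOrder.Language.{u, v}} {M : Type w} [MetricSpace M] [MetricStructure L M]

theorem termValue_aut {α : Type*} (g : Aut L M) (x : α → M) (t : L.Term α) :
    termValue (fun i => g.1 (x i)) t = g.1 (termValue x t) := by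
  induction t with
  | var i => rfl
  | func f ts ih =>
    simp only [termValue, ih]
    exact (g.2.1 _ f _).symm

/-- Induction on formulas; at a quantifier, surjectivity of `g` allows the bound variable to be
replaced by its image. -/
theorem value_aut (g : Aut L M) {n : ℕ} (φ : MetricFormula L n) (x : Fin n → M) :
    φ.value (fun i => g.1 (x i)) = φ.value x := by
  induction φ with
  | pred P ts =>
    simp only [MetricFormula.value, termValue_aut]
    exact g.2.2 _ P _
  | dist t₁ t₂ =>
    simp only [MetricFormula.value, termValue_aut]
    exact g.1.isometry.dist_eq _ _
  | connective θ φ ih => simp only [MetricFormula.value, ih]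
  | sup φ ih =>
    simp only [MetricFormula.value]
    refine (Function.Surjective.iSup_congr g.1 g.1.surjective fun y => ?_).symm
    rw [← ih (Fin.snoc x y)]
    congr 1
    exact (Fin.comp_snoc g.1 x y).symm
  | inf φ ih =>
    simp only [MetricFormula.value]
    refine (Function.Surjective.iInf_congr g.1 g.1.surjective fun y => ?_).symm
    rw [← ih (Fin.snoc x y)]
    congr 1
    exact (Fin.comp_snoc g.1 x y).symm

theorem IsDefinablePredicate.apply_aut {n : ℕ} {φ : (Fin n → M) → unitInterval}
    (h : IsDefinablePredicate L M φ) (g : Aut L M) (x : Fin n → M) :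
    φ (fun i => g.1 (x i)) = φ x := by
  refine Subtype.ext (eq_of_forall_dist_le fun ε hε => ?_)
  obtain ⟨ψ, hψ⟩ := h (ε / 2) (half_pos hε)
  have h1 := abs_le.1 (hψ x)
  have h2 := abs_le.1 (hψ fun i => g.1 (x i))
  rw [value_aut] at h2
  rw [Real.dist_eq, abs_le]
  constructor <;> linarith [h1.1, h1.2, h2.1, h2.2]

/-- Isometries are equicontinuous, so pointwise convergence suffices for joint continuity. -/
theorem continuous_aut_apply : Continuous fun p : Aut L M × M => p.1.1 p.2 := by
  refine continuous_iff_continuousAt.2 fun p => tendsto_iff_dist_tendsto_zero.2 ?_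
  have h1 : Filter.Tendsto (fun q : Aut L M × M => dist q.2 p.2 + dist (q.1.1 p.2) (p.1.1 p.2))
      (𝓝 p) (𝓝 (0 + 0)) := by
    refine Filter.Tendsto.add (tendsto_iff_dist_tendsto_zero.1 (continuous_snd.tendsto p))
      (tendsto_iff_dist_tendsto_zero.1 (Continuous.tendsto ?_ p))
    exact (continuous_eval_isometry p.2).comp (continuous_subtype_val.comp continuous_fst)
  rw [add_zero] at h1
  refine squeeze_zero (fun _ => dist_nonneg) (fun q => ?_) h1
  refine (dist_triangle _ (q.1.1 p.2) _).trans_eq ?_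
  rw [q.1.1.isometry.dist_eq]

end Invariance

/-! ### The action of the wreath product on random variables. -/

section Action

variable {Ω : Type z} [MeasurableSpace Ω] {μ : Measure Ω}

theorem coeFn_autAct {X : Type*} [TopologicalSpace X] (t : measurePreservingPerms μ)
    (r : Ω →ₘ[μ] X) : autAct μ (t : AutMeasure μ) r =ᵐ[μ] fun ω => r (t.1.symm ω) :=
  AEEqFun.coeFn_compMeasurePreserving r t.2.2

theorem autAct_const {X : Type*} [TopologicalSpace X] (t : AutMeasure μ) (x : X) :
    autAct μ t (AEEqFun.const Ω x) = AEEqFun.const Ω x := by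
  obtain ⟨t, rfl⟩ := QuotientGroup.mk_surjective t
  rfl

theorem autAct_comp {X Y : Type*} [TopologicalSpace X] [TopologicalSpace Y] (t : AutMeasure μ)
    {f : X → Y} (hf : Continuous f) (r : Ω →ₘ[μ] X) :
    autAct μ t (AEEqFun.comp f hf r) = AEEqFun.comp f hf (autAct μ t r) := by
  obtain ⟨t, rfl⟩ := QuotientGroup.mk_surjective t
  induction r using AEEqFun.induction_on with
  | H r hr => rfl

theorem autAct_comp₂ {X Y Z : Type*} [TopologicalSpace X] [TopologicalSpace Y]
    [TopologicalSpace Z] (t : AutMeasure μ) {f : X → Y → Z} (hf : Continuous (Function.uncurry f))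
    (r : Ω →ₘ[μ] X) (s : Ω →ₘ[μ] Y) :
    autAct μ t (AEEqFun.comp₂ f hf r s) = AEEqFun.comp₂ f hf (autAct μ t r) (autAct μ t s) := by
  obtain ⟨t, rfl⟩ := QuotientGroup.mk_surjective t
  induction r using AEEqFun.induction_on with
  | H r hr =>
    induction s using AEEqFun.induction_on with
    | H s hs => rfl

theorem integral_comp_measurePreserving {T : Ω → Ω} (hT : MeasurePreserving T μ μ) {f : Ω → ℝ}
    (hf : AEStronglyMeasurable f μ) : ∫ ω, f (T ω) ∂μ = ∫ ω, f ω ∂μ := by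
  have h := integral_map hT.measurable.aemeasurable (f := f) (by rwa [hT.map_eq])
  rw [hT.map_eq] at h
  exact h.symm

theorem integral_autAct [IsProbabilityMeasure μ] {X : Type*} [TopologicalSpace X]
    {ρ : X → X → ℝ} (hρ : IsBoundedMetric ρ) (t : AutMeasure μ) (r s : Ω →ₘ[μ] X) :
    ∫ ω, ρ (autAct μ t r ω) (autAct μ t s ω) ∂μ = ∫ ω, ρ (r ω) (s ω) ∂μ := by
  obtain ⟨t, rfl⟩ := QuotientGroup.mk_surjective t
  rw [← integral_comp_measurePreserving t.2.2 (hρ.integrable r s).aestronglyMeasurable]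
  refine integral_congr_ae ?_
  filter_upwards [coeFn_autAct t r, coeFn_autAct t s] with ω h1 h2
  rw [h1, h2]

variable {L : FirstOrder.Language.{u, v}} {M : Type w} [MetricSpace M] [MetricStructure L M]

variable (μ L M) in
/-- The pointwise action of `L⁰(Ω, Aut(M))` on `L⁰(Ω, M)`. -/
noncomputable def pointwiseAct : (Ω →ₘ[μ] Aut L M) →* Equiv.Perm (Ω →ₘ[μ] M) :=
  MonoidHom.toHomPerm
    { toFun := fun g => AEEqFun.comp₂ (fun (g : Aut L M) x => g.1 x) continuous_aut_apply g
      map_one' := by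
        funext r
        induction r using AEEqFun.induction_on with
        | H f hf => rfl
      map_mul' := fun g h => by
        funext r
        induction g using AEEqFun.induction_on with
        | H g hg =>
          induction h using AEEqFun.induction_on with
          | H h hh =>
            induction r using AEEqFun.induction_on with
            | H f hf => rfl }

theorem coeFn_pointwiseAct (g : Ω →ₘ[μ] Aut L M) (r : Ω →ₘ[μ] M) :
    pointwiseAct μ L M g r =ᵐ[μ] fun ω => (g ω).1 (r ω) :=
  AEEqFun.coeFn_comp₂ _ continuous_aut_apply g r

variable (μ L M) in
/-- The action of the measurable wreath product on `L⁰(Ω, M)`. -/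
noncomputable def wreathMain : MeasurableWreath μ (Aut L M) →* Equiv.Perm (Ω →ₘ[μ] M) :=
  SemidirectProduct.lift (pointwiseAct μ L M) (autAct μ) (by
    intro t
    obtain ⟨t, rfl⟩ := QuotientGroup.mk_surjective t
    ext1 g
    refine Equiv.ext fun r => ?_
    -- Writing the argument as a translate cancels the inverse in the conjugation, leaving an
    -- identity that holds by definition on representatives.
    obtain ⟨r, rfl⟩ := (autAct μ (t : AutMeasure μ)).surjective r
    change pointwiseAct μ L M (autAct μ (t : AutMeasure μ) g) (autAct μ (t : AutMeasure μ) r) =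
      autAct μ (t : AutMeasure μ) (pointwiseAct μ L M g ((autAct μ (t : AutMeasure μ))⁻¹
        (autAct μ (t : AutMeasure μ) r)))
    rw [show (autAct μ (t : AutMeasure μ))⁻¹ (autAct μ (t : AutMeasure μ) r) = r from
      Equiv.symm_apply_apply _ r]
    induction g using AEEqFun.induction_on with
    | H g hg =>
      induction r using AEEqFun.induction_on with
      | H r hr => rfl)

theorem wreathMain_apply (w : MeasurableWreath μ (Aut L M)) (r : Ω →ₘ[μ] M) :
    wreathMain μ L M w r = pointwiseAct μ L M w.left (autAct μ w.right r) :=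
  rfl

theorem coeFn_wreathMain (g : Ω →ₘ[μ] Aut L M) (t : measurePreservingPerms μ) (r : Ω →ₘ[μ] M) :
    wreathMain μ L M ⟨g, (t : AutMeasure μ)⟩ r =ᵐ[μ] fun ω => (g ω).1 (r (t.1.symm ω)) := by
  filter_upwards [coeFn_pointwiseAct g (autAct μ (t : AutMeasure μ) r), coeFn_autAct t r]
    with ω h1 h2
  rw [wreathMain_apply, h1, h2]

variable (μ L M) in
/-- The action of the measurable wreath product on `L⁰(Ω, [0, 1])`. -/
noncomputable def wreathAux :
    MeasurableWreath μ (Aut L M) →* Equiv.Perm (Ω →ₘ[μ] unitInterval) :=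
  (autAct μ).comp SemidirectProduct.rightHom

theorem coeFn_wreathAux (g : Ω →ₘ[μ] Aut L M) (t : measurePreservingPerms μ)
    (R : Ω →ₘ[μ] unitInterval) :
    wreathAux μ L M ⟨g, (t : AutMeasure μ)⟩ R =ᵐ[μ] fun ω => R (t.1.symm ω) :=
  coeFn_autAct t R

theorem integral_dist_wreathMain [IsProbabilityMeasure μ] [BoundedSpace M]
    (w : MeasurableWreath μ (Aut L M)) (r s : Ω →ₘ[μ] M) :
    ∫ ω, dist (wreathMain μ L M w r ω) (wreathMain μ L M w s ω) ∂μ =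
      ∫ ω, dist (r ω) (s ω) ∂μ := by
  refine Eq.trans (integral_congr_ae ?_) (integral_autAct (isBoundedMetric_dist M) w.right r s)
  filter_upwards [coeFn_pointwiseAct w.left (autAct μ w.right r),
    coeFn_pointwiseAct w.left (autAct μ w.right s)] with ω h1 h2
  rw [wreathMain_apply, wreathMain_apply, h1, h2]
  exact (w.left ω).1.isometry.dist_eq _ _

end Action

/-! ### The homomorphism from the wreath product to `Aut(M^R)`. -/

section Homomorphism

variable {Ω : Type w} [MeasurableSpace Ω] (μ : Measure Ω) [IsProbabilityMeasure μ]
  (L : FirstOrder.Language.{u, v}) (M : Type w) [MetricSpace M] [BoundedSpace M]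
  [TopologicalSpace.SeparableSpace M] [Nonempty M] [MetricStructure L M]

/-- The action of the measurable wreath product on the sorts of the randomization. -/
noncomputable def wreathIsometry (w : MeasurableWreath μ (Aut L M)) : ∀ s : RSort,
    (borelRandomization μ L M).Carrier s ≃ᵢ (borelRandomization μ L M).Carrier s
  | .main =>
    letI : MetricSpace (Ω →ₘ[μ] M) := integralMetric μ (isBoundedMetric_dist M)
    { toEquiv := wreathMain μ L M w
      isometry_toFun := Isometry.of_dist_eq (integral_dist_wreathMain w) }
  | .aux =>
    letI : MetricSpace (Ω →ₘ[μ] unitInterval) :=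
      integralMetric μ (isBoundedMetric_dist unitInterval)
    { toEquiv := wreathAux μ L M w
      isometry_toFun := Isometry.of_dist_eq
        (integral_autAct (isBoundedMetric_dist unitInterval) w.right) }

omit [IsProbabilityMeasure μ] [BoundedSpace M] [Nonempty M] in
theorem coeFn_eventMap {n : ℕ} {φ : (Fin n → M) → unitInterval} (hφ : Continuous φ)
    (r : Fin n → (Ω →ₘ[μ] M)) : eventMap μ hφ r =ᵐ[μ] fun ω => φ fun i => r i ω :=
  AEEqFun.coeFn_mk _ _

-- Each `g ω` preserves `φ`, so on the values of `φ` only the change of variable by `t` remains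
-- visible.
omit [IsProbabilityMeasure μ] in
theorem wreathAux_eventMap (w : MeasurableWreath μ (Aut L M)) {n : ℕ}
    {φ : (Fin n → M) → unitInterval} (hφ : IsDefinablePredicate L M φ)
    (r : Fin n → (Ω →ₘ[μ] M)) :
    wreathAux μ L M w (eventMap μ hφ.continuous r) =
      eventMap μ hφ.continuous fun i => wreathMain μ L M w (r i) := by
  obtain ⟨g, t⟩ := w
  obtain ⟨t, rfl⟩ := QuotientGroup.mk_surjective t
  refine AEEqFun.ext ?_
  filter_upwards [coeFn_wreathAux g t (eventMap μ hφ.continuous r),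
    coeFn_eventMap μ M hφ.continuous fun i => wreathMain μ L M ⟨g, (t : AutMeasure μ)⟩ (r i),
    t.2.2.quasiMeasurePreserving.ae (coeFn_eventMap μ M hφ.continuous r),
    ae_all_iff.2 fun i => coeFn_wreathMain g t (r i)] with ω h1 h2 h3 h4
  refine h1.trans (h3.trans ?_)
  rw [h2]
  simp only [h4]
  exact (hφ.apply_aut (g ω) _).symm

theorem wreathIsometry_mem (w : MeasurableWreath μ (Aut L M)) :
    wreathIsometry μ L M w ∈ (borelRandomization μ L M).Aut := by
  refine ⟨?_, ?_⟩
  · intro f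
    match f with
    | .event n φ h => exact fun r => wreathAux_eventMap μ L M w h r
    | .zero => exact fun _ => autAct_const w.right 0
    | .neg =>
      exact fun R => autAct_comp w.right unitInterval.continuous_symm (R (0 : Fin 1))
    | .half => exact fun R => autAct_comp w.right continuous_unitHalf (R (0 : Fin 1))
    | .monus =>
      exact fun R => autAct_comp₂ w.right continuous_unitMonus (R (0 : Fin 2)) (R (1 : Fin 2))
  · rintro ⟨⟩ R
    obtain ⟨g, t⟩ := w
    obtain ⟨t, rfl⟩ := QuotientGroup.mk_surjective t
    have key : ∀ R : Ω →ₘ[μ] unitInterval,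
        ∫ ω, (wreathAux μ L M ⟨g, (t : AutMeasure μ)⟩ R ω : ℝ) ∂μ = ∫ ω, (R ω : ℝ) ∂μ := by
      intro R
      rw [← integral_comp_measurePreserving t.2.2
        (continuous_subtype_val.comp_aestronglyMeasurable R.aestronglyMeasurable)]
      refine integral_congr_ae ?_
      filter_upwards [coeFn_wreathAux g t R] with ω h
      rw [h]
    exact key (R (0 : Fin 1))

/-- The action of the measurable wreath product by automorphisms of the randomization. -/
noncomputable def wreathHom :
    MeasurableWreath μ (Aut L M) →* (borelRandomization μ L M).Aut where
  toFun w := ⟨wreathIsometry μ L M w, wreathIsometry_mem μ L M w⟩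
  map_one' := by
    refine Subtype.ext (funext fun s => IsometryEquiv.ext fun x => ?_)
    cases s with
    | main => exact congrArg (fun σ : Equiv.Perm (Ω →ₘ[μ] M) => σ x) (map_one (wreathMain μ L M))
    | aux =>
      exact congrArg (fun σ : Equiv.Perm (Ω →ₘ[μ] unitInterval) => σ x)
        (map_one (wreathAux μ L M))
  map_mul' w₁ w₂ := by
    refine Subtype.ext (funext fun s => IsometryEquiv.ext fun x => ?_)
    cases s with
    | main =>
      exact congrArg (fun σ : Equiv.Perm (Ω →ₘ[μ] M) => σ x) (map_mul (wreathMain μ L M) w₁ w₂)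
    | aux =>
      exact congrArg (fun σ : Equiv.Perm (Ω →ₘ[μ] unitInterval) => σ x)
        (map_mul (wreathAux μ L M) w₁ w₂)

variable {μ L M}

theorem onMain_wreathHom (w : MeasurableWreath μ (Aut L M)) (r : Ω →ₘ[μ] M) :
    onMain (wreathHom μ L M w) r = wreathMain μ L M w r :=
  rfl

theorem onAux_wreathHom (w : MeasurableWreath μ (Aut L M)) (R : Ω →ₘ[μ] unitInterval) :
    onAux (wreathHom μ L M w) R = autAct μ w.right R :=
  rfl

end Homomorphism

/-! ### Automorphisms of `M` read off from a dense sequence. -/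

section DenseSequences

variable {L : FirstOrder.Language.{u, v}} {M : Type w} [MetricSpace M] [MetricStructure L M]

/-- Two dense families with the same distances correspond under a surjective isometry. -/
theorem exists_isometryEquiv_of_dist_eq {M : Type*} [MetricSpace M] [CompleteSpace M]
    {ι : Type*} {a b : ι → M} (ha : DenseRange a) (hb : DenseRange b)
    (h : ∀ i j, dist (b i) (b j) = dist (a i) (a j)) : ∃ g : M ≃ᵢ M, ∀ i, g (a i) = b i := by
  let : PseudoMetricSpace ι := PseudoMetricSpace.induced a inferInstance
  have ha' : Isometry a := Isometry.of_dist_eq fun i j => rfl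
  have hb' : Isometry b := Isometry.of_dist_eq h
  let A : AbstractCompletion ι :=
    ⟨M, a, inferInstance, inferInstance, inferInstance, ha'.isUniformInducing, ha⟩
  let B : AbstractCompletion ι :=
    ⟨M, b, inferInstance, inferInstance, inferInstance, hb'.isUniformInducing, hb⟩
  let G : M ≃ᵤ M := A.compareEquiv B
  have hG : ∀ i, G (a i) = b i := A.compare_coe B
  refine ⟨⟨G.toEquiv, Isometry.of_dist_eq fun x y => ?_⟩, hG⟩
  refine ha.induction_on₂ (p := fun x y => dist (G x) (G y) = dist x y) ?_ (fun i j => ?_) x y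
  · exact isClosed_eq ((G.continuous.comp continuous_fst).dist (G.continuous.comp continuous_snd))
      continuous_dist
  · rw [hG, hG, h]

/-- The isometry extending `a i ↦ b i` respects the symbols by continuity. The value of a function
symbol need not lie in the sequence, so `hf` locates it by its distances to the sequence; these are
values of formulas, as `value_onMain` requires. -/
theorem exists_aut_of_dense [CompleteSpace M] {a b : ℕ → M} (ha : DenseRange a)
    (hb : DenseRange b) (hd : ∀ i j, dist (b i) (b j) = dist (a i) (a j))
    (hP : ∀ (n : ℕ) (P : L.Relations n) (x : Fin n → ℕ),
      (MetricStructure.predMap P fun i => b (x i)) = MetricStructure.predMap P fun i => a (x i))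
    (hf : ∀ (n : ℕ) (f : L.Functions n) (x : Fin n → ℕ) (k : ℕ),
      dist (MetricStructure.funMap f fun i => b (x i)) (b k) =
        dist (MetricStructure.funMap f fun i => a (x i)) (a k)) :
    ∃ g : Aut L M, ∀ i, g.1 (a i) = b i := by
  obtain ⟨g, hg⟩ := exists_isometryEquiv_of_dist_eq ha hb hd
  have hgc : ∀ n, Continuous fun (x : Fin n → M) i => g (x i) := fun n =>
    continuous_pi fun i => g.continuous.comp (continuous_apply i)
  refine ⟨⟨g, fun n f x => ?_, fun n P x => ?_⟩, hg⟩
  · have hfc := (MetricStructure.uniformContinuous_funMap (M := M) f).continuous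
    refine congrFun ((DenseRange.piMap fun _ : Fin n => ha).equalizer (g.continuous.comp hfc)
      (hfc.comp (hgc n)) (funext fun x => ?_)) x
    have key : ∀ y, dist (MetricStructure.funMap f fun i => b (x i)) (g y) =
        dist (MetricStructure.funMap f fun i => a (x i)) y := by
      refine congrFun (ha.equalizer (continuous_const.dist g.continuous)
        (continuous_const.dist continuous_id) (funext fun k => ?_))
      simpa only [Function.comp_apply, hg] using hf n f x k
    have := key (MetricStructure.funMap f fun i => a (x i))
    rw [dist_self, dist_eq_zero] at this
    simp only [Function.comp_apply, Pi.map_apply, hg]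
    exact this.symm
  · have hPc := (MetricStructure.uniformContinuous_predMap (M := M) P).continuous
    refine congrFun ((DenseRange.piMap fun _ : Fin n => ha).equalizer (hPc.comp (hgc n))
      hPc (funext fun x => ?_)) x
    simp only [Function.comp_apply, Pi.map_apply, hg]
    exact hP n P x

/-- The topology of `Aut(M)` is that of pointwise convergence on a dense sequence. -/
theorem isEmbedding_aut_apply {a : ℕ → M} (ha : DenseRange a) :
    IsEmbedding fun (g : Aut L M) i => g.1 (a i) := by
  have hcont : Continuous fun (g : Aut L M) i => g.1 (a i) := continuous_pi fun i =>
    (continuous_eval_isometry (a i)).comp continuous_subtype_val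
  refine ⟨⟨le_antisymm (continuous_iff_le_induced.1 hcont) ?_⟩, fun g h hgh => ?_⟩
  · rw [← continuous_id_iff_le]
    -- From here the group carries the topology induced by the dense sequence; a three-term estimate
    -- shows that evaluation at every other point is continuous for it.
    let : TopologicalSpace (Aut L M) :=
      TopologicalSpace.induced (fun (g : Aut L M) i => g.1 (a i)) inferInstance
    refine continuous_induced_rng.2 (continuous_isometry_iff.2 fun x =>
      continuous_iff_continuousAt.2 fun p => Metric.tendsto_nhds.2 fun ε hε => ?_)
    obtain ⟨i, hi⟩ := ha.exists_dist_lt x (ε := ε / 3) (by positivity)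
    have hc : Continuous fun g : Aut L M => g.1 (a i) :=
      (continuous_apply i).comp (continuous_induced_dom (f := fun (g : Aut L M) i => g.1 (a i)))
    filter_upwards [Metric.tendsto_nhds.1 (hc.tendsto p) (ε / 3) (by positivity)] with q hq
    calc dist (q.1 x) (p.1 x)
        ≤ dist (q.1 x) (q.1 (a i)) + dist (q.1 (a i)) (p.1 (a i)) + dist (p.1 (a i)) (p.1 x) :=
          dist_triangle4 _ _ _ _
      _ = dist x (a i) + dist (q.1 (a i)) (p.1 (a i)) + dist x (a i) := by
          rw [q.1.isometry.dist_eq, p.1.isometry.dist_eq, dist_comm (a i) x]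
      _ < ε := by linarith
  · refine Subtype.ext (IsometryEquiv.ext fun x => ?_)
    exact congrFun (ha.equalizer g.1.continuous h.1.continuous hgh) x

end DenseSequences

/-! ### Every automorphism of the randomization comes from the wreath product. -/

section Values

variable {Ω : Type w} [MeasurableSpace Ω] {μ : Measure Ω} [IsProbabilityMeasure μ]
  {L : FirstOrder.Language.{u, v}} {M : Type w} [MetricSpace M] [BoundedSpace M]
  [TopologicalSpace.SeparableSpace M] [Nonempty M] [MetricStructure L M]

theorem isAuxHom_onAux (σ : (borelRandomization μ L M).Aut) : IsAuxHom (onAux σ) where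
  isometry := (σ.1 RSort.aux).isometry.dist_eq
  zero := σ.2.1 RFunc.zero Fin.elim0
  neg R := σ.2.1 RFunc.neg fun _ => R
  half R := σ.2.1 RFunc.half fun _ => R
  monus R S := by
    have h := σ.2.1 RFunc.monus (fun i : Fin 2 => (![R, S] i : Ω →ₘ[μ] unitInterval))
    exact h
  expectation R := σ.2.2 RPred.expectation fun _ => R

theorem onAux_eventMap (σ : (borelRandomization μ L M).Aut) {n : ℕ}
    {φ : (Fin n → M) → unitInterval} (h : IsDefinablePredicate L M φ)
    (r : Fin n → (Ω →ₘ[μ] M)) :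
    onAux σ (eventMap μ h.continuous r) = eventMap μ h.continuous fun i => onMain σ (r i) :=
  σ.2.1 (RFunc.event n φ h) r

theorem onMain_apply_inv (σ : (borelRandomization μ L M).Aut) (r : Ω →ₘ[μ] M) :
    onMain σ (onMain σ⁻¹ r) = r :=
  (σ.1 RSort.main).apply_symm_apply r

theorem onAux_apply_inv (σ : (borelRandomization μ L M).Aut) (R : Ω →ₘ[μ] unitInterval) :
    onAux σ (onAux σ⁻¹ R) = R :=
  (σ.1 RSort.aux).apply_symm_apply R

/-- An automorphism of the randomization acts on the auxiliary sort as an element of `Aut(Ω)`. -/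
theorem exists_autAct_eq_onAux [StandardBorelSpace Ω] [NullSingletonClass μ]
    (σ : (borelRandomization μ L M).Aut) :
    ∃ t : measurePreservingPerms μ, ∀ R, onAux σ R = autAct μ (t : AutMeasure μ) R := by
  obtain ⟨T, hT, hTσ⟩ := (isAuxHom_onAux σ).exists_measurePreserving
  obtain ⟨S, hS, hSσ⟩ := (isAuxHom_onAux σ⁻¹).exists_measurePreserving
  have hI : ¬ Countable unitInterval := not_countable_of_nullSingletonClass volume
  let h : Ω ≃ᵐ unitInterval :=
    PolishSpace.measurableEquivOfNotCountable (not_countable_of_nullSingletonClass μ) hI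
  let H : Ω →ₘ[μ] unitInterval := AEEqFun.mk h h.measurable.aestronglyMeasurable
  have hH : H =ᵐ[μ] h := AEEqFun.coeFn_mk _ _
  -- Evaluating `σ (σ⁻¹ H) = H` gives `h (S (T ω)) = h ω`, and `h` is injective.
  have hST : ∀ᵐ ω ∂μ, S (T ω) = ω := by
    have e := hTσ (onAux σ⁻¹ H)
    rw [onAux_apply_inv] at e
    filter_upwards [e, hH, hT.quasiMeasurePreserving.ae (hSσ H),
      (hS.comp hT).quasiMeasurePreserving.ae hH] with ω h1 h2 h3 h4
    apply h.injective
    rw [← h2, h1, h3]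
    exact h4.symm
  obtain ⟨t, ht⟩ := exists_measurePreservingPerm μ hT hS hST
  refine ⟨t, fun R => AEEqFun.ext ?_⟩
  filter_upwards [hTσ R, coeFn_autAct t R, ht] with ω h1 h2 h3
  rw [h1, h2, h3]

/-- Automorphisms of the randomization preserve the random values of all formulas, up to the
action on `Ω`. -/
theorem value_onMain {σ : (borelRandomization μ L M).Aut} {t : measurePreservingPerms μ}
    (ht : ∀ R, onAux σ R = autAct μ (t : AutMeasure μ) R) {n : ℕ} (ψ : MetricFormula L n)
    (r : Fin n → (Ω →ₘ[μ] M)) :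
    ∀ᵐ ω ∂μ, (ψ.value fun i => onMain σ (r i) ω) = ψ.value fun i => r i (t.1.symm ω) := by
  obtain ⟨-, C, hC⟩ := ψ.uniformContinuous_and_bounded (M := M)
  have hB : 0 < |C| + 1 := by positivity
  have hCB : ∀ x : Fin n → M, |ψ.value x / (2 * (|C| + 1))| ≤ 1 / 2 := by
    intro x
    rw [abs_div, abs_of_pos (by positivity : 0 < 2 * (|C| + 1)), div_le_div_iff₀ (by positivity)
      two_pos]
    linarith [hC x, le_abs_self C]
  let θ : C(Fin 1 → ℝ, ℝ) := ⟨fun v => v 0 / (2 * (|C| + 1)) + 1 / 2, by fun_prop⟩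
  -- The formula is rescaled affinely into `[0, 1]` to become a definable predicate; the `1` added
  -- to `|C|` keeps the divisor nonzero.
  let φ : (Fin n → M) → unitInterval := fun x =>
    ⟨ψ.value x / (2 * (|C| + 1)) + 1 / 2, by linarith [(abs_le.1 (hCB x)).1],
      by linarith [(abs_le.1 (hCB x)).2]⟩
  have hφ : IsDefinablePredicate L M φ := fun ε hε =>
    ⟨.connective θ fun _ => ψ, fun x => by simpa [MetricFormula.value, φ, θ] using hε.le⟩
  have e := onAux_eventMap σ hφ r
  rw [ht] at e
  filter_upwards [coeFn_eventMap μ M hφ.continuous fun i => onMain σ (r i),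
    coeFn_autAct t (eventMap μ hφ.continuous r),
    t.2.2.quasiMeasurePreserving.ae (coeFn_eventMap μ M hφ.continuous r)] with ω h1 h2 h3
  rw [e, h1] at h2
  have h4 := congrArg Subtype.val (h2.trans h3)
  simp only [φ] at h4
  have h5 := add_right_cancel h4
  exact (div_left_inj' (by positivity)).1 h5

theorem dist_onMain {σ : (borelRandomization μ L M).Aut} {t : measurePreservingPerms μ}
    (ht : ∀ R, onAux σ R = autAct μ (t : AutMeasure μ) R) (r s : Ω →ₘ[μ] M) :
    ∀ᵐ ω ∂μ, dist (onMain σ r ω) (onMain σ s ω) = dist (r (t.1.symm ω)) (s (t.1.symm ω)) := by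
  have h := value_onMain ht (.dist (.var 0) (.var 1)) ![r, s]
  simpa [MetricFormula.value, termValue] using h

/-- The images of constants from a dense sequence determine an automorphism of `M` at almost every
`ω`, and distances to these images then determine `σ r` for all `r`. -/
theorem exists_pointwiseAct_eq_onMain [CompleteSpace M] [Countable L.Symbols]
    {σ : (borelRandomization μ L M).Aut} {t : measurePreservingPerms μ}
    (ht : ∀ R, onAux σ R = autAct μ (t : AutMeasure μ) R) :
    ∃ g : Ω →ₘ[μ] Aut L M,
      ∀ r, onMain σ r = pointwiseAct μ L M g (autAct μ (t : AutMeasure μ) r) := by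
  have : Countable (Σ n, L.Functions n) :=
    Function.Injective.countable (f := (Sum.inl : _ → L.Symbols)) Sum.inl_injective
  have : Countable (Σ n, L.Relations n) :=
    Function.Injective.countable (f := (Sum.inr : _ → L.Symbols)) Sum.inr_injective
  have cf : ∀ n, Countable (L.Functions n) := fun n =>
    Function.Injective.countable (f := fun f => (⟨n, f⟩ : Σ n, L.Functions n))
      sigma_mk_injective
  have cr : ∀ n, Countable (L.Relations n) := fun n =>
    Function.Injective.countable (f := fun f => (⟨n, f⟩ : Σ n, L.Relations n))
      sigma_mk_injective
  let a : ℕ → M := TopologicalSpace.denseSeq M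
  have ha : DenseRange a := TopologicalSpace.denseRange_denseSeq M
  let b : ℕ → Ω → M := fun i => onMain σ (AEEqFun.const Ω (a i))
  have hconst : ∀ᵐ ω ∂μ, ∀ i, (AEEqFun.const Ω (a i) : Ω →ₘ[μ] M) ω = a i :=
    ae_all_iff.2 fun i => AEEqFun.coeFn_const Ω (a i)
  have hconst' : ∀ᵐ ω ∂μ, ∀ i, (AEEqFun.const Ω (a i) : Ω →ₘ[μ] M) (t.1.symm ω) = a i :=
    t.2.2.quasiMeasurePreserving.ae hconst
  have h1 : ∀ᵐ ω ∂μ, ∀ i j, dist (b i ω) (b j ω) = dist (a i) (a j) := by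
    filter_upwards [hconst', ae_all_iff.2 fun i => ae_all_iff.2 fun j =>
      dist_onMain ht (AEEqFun.const Ω (a i)) (AEEqFun.const Ω (a j))] with ω h2 h3 i j
    rw [h3 i j, h2, h2]
  -- Surjectivity of `σ` enters here: if `a i` is close to the value of `σ⁻¹ (a k)` at `t⁻¹ ω`, then
  -- `b i ω` is equally close to `a k`.
  have h2 : ∀ᵐ ω ∂μ, DenseRange fun i => b i ω := by
    filter_upwards [hconst, hconst', ae_all_iff.2 fun k => ae_all_iff.2 fun i =>
      dist_onMain ht (onMain σ⁻¹ (AEEqFun.const Ω (a k))) (AEEqFun.const Ω (a i))]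
      with ω h3 h4 h5
    refine (Dense.mono ?_ ha).of_closure
    rintro _ ⟨k, rfl⟩
    refine Metric.mem_closure_iff.2 fun ε hε => ?_
    obtain ⟨i, hi⟩ := ha.exists_dist_lt
      ((onMain σ⁻¹ (AEEqFun.const Ω (a k)) : Ω →ₘ[μ] M) (t.1.symm ω)) hε
    refine ⟨_, ⟨i, rfl⟩, ?_⟩
    have := h5 k i
    rw [onMain_apply_inv, h3, h4] at this
    exact this.trans_lt hi
  have h3 : ∀ᵐ ω ∂μ, ∀ (n : ℕ) (P : L.Relations n) (x : Fin n → ℕ),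
      (MetricStructure.predMap P fun i => b (x i) ω) =
        MetricStructure.predMap P fun i => a (x i) := by
    filter_upwards [hconst', ae_all_iff.2 fun n => ae_all_iff.2 fun P : L.Relations n =>
      ae_all_iff.2 fun x : Fin n → ℕ => value_onMain ht (.pred P fun i => .var i)
        fun i => AEEqFun.const Ω (a (x i))] with ω h4 h5 n P x
    simpa only [MetricFormula.value, termValue, h4] using h5 n P x
  have h4 : ∀ᵐ ω ∂μ, ∀ (n : ℕ) (f : L.Functions n) (x : Fin n → ℕ) (k : ℕ),
      dist (MetricStructure.funMap f fun i => b (x i) ω) (b k ω) =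
        dist (MetricStructure.funMap f fun i => a (x i)) (a k) := by
    filter_upwards [hconst', ae_all_iff.2 fun n => ae_all_iff.2 fun f : L.Functions n =>
      ae_all_iff.2 fun x : Fin n → ℕ => ae_all_iff.2 fun k => value_onMain ht
        (.dist (.func f fun i => .var i.castSucc) (.var (Fin.last n)))
        (Fin.snoc (fun i => AEEqFun.const Ω (a (x i))) (AEEqFun.const Ω (a k)))]
      with ω h5 h6 n f x k
    simpa [MetricFormula.value, termValue, h5] using h6 n f x k
  classical
  let G : Ω → Aut L M := fun ω =>
    if h : ∃ g : Aut L M, ∀ i, g.1 (a i) = b i ω then h.choose else 1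
  have hG : ∀ᵐ ω ∂μ, ∀ i, (G ω).1 (a i) = b i ω := by
    filter_upwards [h1, h2, h3, h4] with ω h5 h6 h7 h8
    have h : ∃ g : Aut L M, ∀ i, g.1 (a i) = b i ω := exists_aut_of_dense ha h6 h5 h7 h8
    simp only [G, dif_pos h]
    exact h.choose_spec
  -- `G` is defined by choice, with value `1` where no automorphism exists. Its measurability is
  -- tested through the embedding `g ↦ (g (a i))ᵢ`, whose coordinates agree almost everywhere with
  -- the measurable `b i`.
  have hGm : AEStronglyMeasurable G μ := by
    refine (isEmbedding_aut_apply ha).aestronglyMeasurable_comp_iff.1 ?_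
    have : SecondCountableTopology M := UniformSpace.secondCountable_of_separable M
    borelize M
    refine AEMeasurable.aestronglyMeasurable (aemeasurable_pi_lambda _ fun i => ?_)
    refine (AEEqFun.measurable _).aemeasurable.congr (f := b i) ?_
    filter_upwards [hG] with ω h5 using (h5 i).symm
  refine ⟨AEEqFun.mk G hGm, fun r => AEEqFun.ext ?_⟩
  filter_upwards [hG, hconst', AEEqFun.coeFn_mk G hGm,
    coeFn_pointwiseAct (AEEqFun.mk G hGm) (autAct μ (t : AutMeasure μ) r), coeFn_autAct t r,
    ae_all_iff.2 fun i => dist_onMain ht r (AEEqFun.const Ω (a i))] with ω h5 h6 h7 h8 h9 h10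
  rw [h8, h7, h9]
  -- True for `y = a i`, hence for all `y` by density; the choice `y = r (t⁻¹ ω)` then makes the
  -- distance vanish.
  have key : ∀ y, dist (onMain σ r ω) ((G ω).1 y) = dist (r (t.1.symm ω)) y := by
    refine congrFun (ha.equalizer (continuous_const.dist (G ω).1.continuous)
      (continuous_const.dist continuous_id) (funext fun i => ?_))
    have := h10 i
    rw [h6] at this
    simpa only [Function.comp_apply, h5] using this
  have := key (r (t.1.symm ω))
  rwa [dist_self, dist_eq_zero] at this

theorem wreathHom_surjective [StandardBorelSpace Ω] [NullSingletonClass μ] [CompleteSpace M]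
    [Countable L.Symbols] : Function.Surjective (wreathHom μ L M) := by
  intro σ
  obtain ⟨t, ht⟩ := exists_autAct_eq_onAux σ
  obtain ⟨g, hg⟩ := exists_pointwiseAct_eq_onMain ht
  refine ⟨⟨g, (t : AutMeasure μ)⟩, Subtype.ext (funext fun s => IsometryEquiv.ext fun x => ?_)⟩
  cases s with
  | main => exact (hg x).symm
  | aux => exact (ht x).symm

-- Testing on a Borel isomorphism from `Ω` to `[0, 1]`, which separates points, suffices.
omit [IsProbabilityMeasure μ] in
theorem eq_one_of_autAct_eq_self [StandardBorelSpace Ω] [NeZero μ] [NullSingletonClass μ]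
    {τ : AutMeasure μ} (h : ∀ R : Ω →ₘ[μ] unitInterval, autAct μ τ R = R) : τ = 1 := by
  obtain ⟨t, rfl⟩ := QuotientGroup.mk_surjective τ
  have hI : ¬ Countable unitInterval := not_countable_of_nullSingletonClass volume
  let e : Ω ≃ᵐ unitInterval :=
    PolishSpace.measurableEquivOfNotCountable (not_countable_of_nullSingletonClass μ) hI
  let H : Ω →ₘ[μ] unitInterval := AEEqFun.mk e e.measurable.aestronglyMeasurable
  have hH : H =ᵐ[μ] e := AEEqFun.coeFn_mk _ _
  have ht : ∀ᵐ ω ∂μ, t.1.symm ω = ω := by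
    have h1 := coeFn_autAct t H
    rw [h] at h1
    filter_upwards [h1, hH, t.2.2.quasiMeasurePreserving.ae hH] with ω h2 h3 h4
    exact e.injective (h4.symm.trans (h2.symm.trans h3))
  refine (QuotientGroup.eq_one_iff t).2 ?_
  exact inv_mem_iff.1 (show t⁻¹ ∈ aeTrivialPerms μ from ht)

theorem wreathHom_injective [StandardBorelSpace Ω] [NullSingletonClass μ] :
    Function.Injective (wreathHom μ L M) := by
  refine (injective_iff_map_eq_one _).2 ?_
  rintro ⟨g, τ⟩ hw
  have hτ : τ = 1 := eq_one_of_autAct_eq_self fun R => by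
    have := onAux_wreathHom (⟨g, τ⟩ : MeasurableWreath μ (Aut L M)) R
    rw [hw] at this
    exact this.symm
  subst hτ
  have hg : g = 1 := by
    let a : ℕ → M := TopologicalSpace.denseSeq M
    have ha : DenseRange a := TopologicalSpace.denseRange_denseSeq M
    have key : ∀ i, pointwiseAct μ L M g (AEEqFun.const Ω (a i)) = AEEqFun.const Ω (a i) := by
      intro i
      have := onMain_wreathHom (⟨g, 1⟩ : MeasurableWreath μ (Aut L M)) (AEEqFun.const Ω (a i))
      rw [hw] at this
      exact this.symm
    refine AEEqFun.ext ?_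
    filter_upwards [ae_all_iff.2 fun i => coeFn_pointwiseAct g (AEEqFun.const Ω (a i)),
      ae_all_iff.2 fun i => AEEqFun.coeFn_const (μ := μ) Ω (a i),
      AEEqFun.coeFn_one (α := Ω) (μ := μ) (β := Aut L M)] with ω h1 h2 h3
    rw [h3]
    refine (isEmbedding_aut_apply ha).injective (funext fun i => ?_)
    have := h1 i
    rw [key, h2] at this
    exact this.symm
  subst hg
  rfl

end Values

/-! ### Continuity of the two actions. -/

section ContinuityOfActions

open Filter

variable {Ω : Type z} [MeasurableSpace Ω] {μ : Measure Ω} [IsProbabilityMeasure μ]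

theorem tendsto_of_compatibleDist {X ι : Type*} [TopologicalSpace X]
    [TopologicalSpace.MetrizableSpace X] {l : Filter ι} {f : ι → X} {x : X}
    (h : Tendsto (fun i => compatibleDist X (f i) x) l (𝓝 0)) : Tendsto f l (𝓝 x) := by
  let := TopologicalSpace.metrizableSpaceMetric X
  refine Metric.tendsto_nhds.2 fun ε hε => ?_
  filter_upwards [h.eventually (gt_mem_nhds (lt_min one_pos hε))] with i hi
  have hi' : min 1 (dist (f i) x) < min 1 ε := hi
  exact (min_lt_min_right_iff.1 hi').1

theorem tendsto_autAct_aux (τ : AutMeasure μ) (R : Ω →ₘ[μ] unitInterval) :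
    Tendsto (fun τ' => ∫ ω, dist (autAct μ τ' R ω) (autAct μ τ R ω) ∂μ) (𝓝 τ) (𝓝 0) := by
  let : MetricSpace (Ω →ₘ[μ] unitInterval) := integralMetric μ (isBoundedMetric_dist unitInterval)
  have hc : Continuous fun τ' : AutMeasure μ => autAct μ τ' R :=
    (continuous_apply R).comp (continuous_induced_dom
      (f := fun (t : AutMeasure μ) (R : Ω →ₘ[μ] unitInterval) => autAct μ t R))
  exact tendsto_iff_dist_tendsto_zero.1 (hc.tendsto τ)

/-- The topology of `Aut(Ω)` only speaks of `[0, 1]`-valued variables; rescaled distances to a dense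
sequence are such variables and control convergence in `L⁰(Ω, M)`. -/
theorem tendsto_autAct {M : Type*} [MetricSpace M] [BoundedSpace M]
    [TopologicalSpace.SeparableSpace M] [Nonempty M] (τ : AutMeasure μ) (r : Ω →ₘ[μ] M) :
    Tendsto (fun τ' => ∫ ω, dist (autAct μ τ' r ω) (autAct μ τ r ω) ∂μ) (𝓝 τ) (𝓝 0) := by
  obtain ⟨C, hC⟩ := (isBoundedMetric_dist M).bounded
  have hC0 : 0 ≤ C := by
    obtain ⟨x⟩ := (inferInstance : Nonempty M)
    simpa using hC x x
  have hC1 : 0 < C + 1 := by positivity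
  refine tendsto_integral_dist (TopologicalSpace.denseRange_denseSeq M) _ _ fun n => ?_
  let f : M → unitInterval := fun x => ⟨dist x (TopologicalSpace.denseSeq M n) / (C + 1),
    by positivity, (div_le_one hC1).2 ((hC _ _).trans (by linarith))⟩
  have hf : Continuous f := Continuous.subtype_mk
    ((continuous_id.dist continuous_const).div_const _) _
  have h := (tendsto_autAct_aux τ (AEEqFun.comp f hf r)).const_mul (C + 1)
  rw [mul_zero] at h
  refine h.congr fun τ' => ?_
  rw [← integral_const_mul]
  refine integral_congr_ae ?_
  rw [autAct_comp, autAct_comp]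
  filter_upwards [AEEqFun.coeFn_comp f hf (autAct μ τ' r), AEEqFun.coeFn_comp f hf (autAct μ τ r)]
    with ω h1 h2
  rw [h1, h2, Subtype.dist_eq, Real.dist_eq]
  simp only [f, Function.comp_apply]
  rw [← sub_div, abs_div, abs_of_pos hC1, mul_div_cancel₀ _ hC1.ne']

variable {L : FirstOrder.Language.{u, v}} {M : Type w} [MetricSpace M] [BoundedSpace M]
  [TopologicalSpace.SeparableSpace M] [MetricStructure L M]

theorem tendsto_pointwiseAct (g : Ω →ₘ[μ] Aut L M) (s : Ω →ₘ[μ] M) :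
    Tendsto (fun g' => ∫ ω, dist (pointwiseAct μ L M g' s ω) (pointwiseAct μ L M g s ω) ∂μ)
      (@nhds _ (randomTopology μ (Aut L M)) g) (𝓝 0) := by
  let : MetricSpace (Ω →ₘ[μ] Aut L M) :=
    integralMetric μ (isBoundedMetric_compatibleDist (Aut L M))
  obtain ⟨C, hC⟩ := (isBoundedMetric_dist M).bounded
  refine Metric.tendsto_nhds_nhds.2 fun ε hε => ?_
  have key : ∃ δ > 0, ∀ g' : Ω →ₘ[μ] Aut L M, dist g' g < δ →
      ∫ ω, dist (pointwiseAct μ L M g' s ω) (pointwiseAct μ L M g s ω) ∂μ < ε := by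
    refine exists_delta_of_seq (C := C)
      (fun g' => (isBoundedMetric_compatibleDist _).integrable g' g)
      (fun g' ω => (isBoundedMetric_compatibleDist _).nonneg _ _)
      (fun g' => ((isBoundedMetric_dist M).integrable _ _).aestronglyMeasurable)
      (fun g' ω => by rw [abs_of_nonneg dist_nonneg]; exact hC _ _) (fun φ => ?_) hε
    filter_upwards [coeFn_pointwiseAct g s, ae_all_iff.2 fun n => coeFn_pointwiseAct (φ n) s]
      with ω h1 h2 h3
    simp only [h1, h2]
    refine tendsto_iff_dist_tendsto_zero.1 ?_
    exact (((continuous_eval_isometry (s ω)).comp continuous_subtype_val).tendsto (g ω)).comp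
      (tendsto_of_compatibleDist h3)
  obtain ⟨δ, hδ, h⟩ := key
  refine ⟨δ, hδ, fun {g'} hg' => ?_⟩
  rw [Real.dist_0_eq_abs, abs_of_nonneg (integral_nonneg fun ω => dist_nonneg)]
  exact h g' hg'

/-- In `L⁰(Ω, Aut(M))`, convergence is detected by the action on a dense sequence of constants. -/
theorem tendsto_of_tendsto_pointwiseAct {ι : Type*} {l : Filter ι} {a : ℕ → M}
    (ha : DenseRange a) {f : ι → (Ω →ₘ[μ] Aut L M)} {g : Ω →ₘ[μ] Aut L M}
    (h : ∀ n, Tendsto (fun i => ∫ ω, dist (pointwiseAct μ L M (f i) (AEEqFun.const Ω (a n)) ω)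
      (pointwiseAct μ L M g (AEEqFun.const Ω (a n)) ω) ∂μ) l (𝓝 0)) :
    Tendsto f l (@nhds _ (randomTopology μ (Aut L M)) g) := by
  let : MetricSpace (Ω →ₘ[μ] Aut L M) :=
    integralMetric μ (isBoundedMetric_compatibleDist (Aut L M))
  obtain ⟨C, hC⟩ := (isBoundedMetric_dist M).bounded
  have hC0 : 0 ≤ C := by simpa using hC (a 0) (a 0)
  obtain ⟨C', hC'⟩ := (isBoundedMetric_compatibleDist (Aut L M)).bounded
  -- The series of the `d g' n`, weighted by `(1 / 2) ^ n`, combines the countably many tests into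
  -- one integrable function, so that `exists_delta_of_seq` applies.
  let d : (Ω →ₘ[μ] Aut L M) → ℕ → Ω → ℝ := fun g' n ω =>
    dist (pointwiseAct μ L M g' (AEEqFun.const Ω (a n)) ω)
      (pointwiseAct μ L M g (AEEqFun.const Ω (a n)) ω)
  have dint : ∀ g' n, Integrable (d g' n) μ := fun g' n =>
    (isBoundedMetric_dist M).integrable _ _
  have dle : ∀ g' n ω, (1 / 2 : ℝ) ^ n * d g' n ω ≤ (1 / 2) ^ n * C := fun g' n ω =>
    mul_le_mul_of_nonneg_left (hC _ _) (by positivity)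
  have d0 : ∀ g' n ω, 0 ≤ (1 / 2 : ℝ) ^ n * d g' n ω := fun g' n ω =>
    mul_nonneg (by positivity) dist_nonneg
  have sumC : Summable fun n : ℕ => (1 / 2 : ℝ) ^ n * C := summable_geometric_two.mul_right C
  have sumd : ∀ g' ω, Summable fun n => (1 / 2 : ℝ) ^ n * d g' n ω := fun g' ω =>
    Summable.of_nonneg_of_le (d0 g' · ω) (dle g' · ω) sumC
  have int0 : ∀ g' n, 0 ≤ (1 / 2 : ℝ) ^ n * ∫ ω, d g' n ω ∂μ := fun g' n =>
    mul_nonneg (by positivity) (integral_nonneg fun ω => dist_nonneg)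
  have intle : ∀ g' n, (1 / 2 : ℝ) ^ n * ∫ ω, d g' n ω ∂μ ≤ (1 / 2) ^ n * C := by
    intro g' n
    refine mul_le_mul_of_nonneg_left ?_ (by positivity)
    have := integral_mono (dint g' n) (integrable_const C) fun ω => hC _ _
    simpa using this
  have normint : ∀ g' n, ∫ ω, ‖(1 / 2 : ℝ) ^ n * d g' n ω‖ ∂μ =
      (1 / 2 : ℝ) ^ n * ∫ ω, d g' n ω ∂μ := by
    intro g' n
    rw [← integral_const_mul]
    refine integral_congr_ae (Eventually.of_forall fun ω => ?_)
    exact Real.norm_of_nonneg (d0 g' n ω)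
  have hsum : ∀ g', HasSum (fun n => (1 / 2 : ℝ) ^ n * ∫ ω, d g' n ω ∂μ)
      (∫ ω, ∑' n, (1 / 2 : ℝ) ^ n * d g' n ω ∂μ) := by
    intro g'
    have := hasSum_integral_of_summable_integral_norm (μ := μ)
      (F := fun n ω => (1 / 2 : ℝ) ^ n * d g' n ω) (fun n => (dint g' n).const_mul _)
      (by simp only [normint]; exact Summable.of_nonneg_of_le (int0 g') (intle g') sumC)
    simpa only [integral_const_mul] using this
  have vint : ∀ g', Integrable (fun ω => ∑' n, (1 / 2 : ℝ) ^ n * d g' n ω) μ := by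
    intro g'
    refine Integrable.of_bound (C := ∑' n : ℕ, (1 / 2 : ℝ) ^ n * C) ?_
      (Eventually.of_forall fun ω => ?_)
    · refine AEMeasurable.aestronglyMeasurable ?_
      have hm : ∀ n, AEMeasurable (fun ω => (1 / 2 : ℝ) ^ n * d g' n ω) μ := fun n =>
        ((dint g' n).const_mul _).aemeasurable
      refine aemeasurable_of_tendsto_metrizable_ae atTop
        (f := fun N ω => ∑ n ∈ Finset.range N, (1 / 2 : ℝ) ^ n * d g' n ω) (fun N => ?_)
        (Eventually.of_forall fun ω => (sumd g' ω).hasSum.tendsto_sum_nat)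
      exact Finset.aemeasurable_fun_sum _ fun n _ => hm n
    · rw [Real.norm_of_nonneg (tsum_nonneg (d0 g' · ω))]
      exact (sumd g' ω).tsum_le_tsum (dle g' · ω) sumC
  -- Integral and sum are interchanged by `hsum`; dominated convergence for series then uses the
  -- hypothesis for each `n`.
  have vlim : Tendsto (fun i => ∫ ω, ∑' n, (1 / 2 : ℝ) ^ n * d (f i) n ω ∂μ) l (𝓝 0) := by
    simp only [← (hsum _).tsum_eq]
    have := tendsto_tsum_of_dominated_convergence (𝓕 := l)
      (f := fun i n => (1 / 2 : ℝ) ^ n * ∫ ω, d (f i) n ω ∂μ) (g := fun _ => (0 : ℝ)) sumC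
      (fun n => by simpa using (h n).const_mul ((1 / 2 : ℝ) ^ n))
      (Eventually.of_forall fun i n => by
        rw [Real.norm_of_nonneg (int0 _ n)]; exact intle _ n)
    simpa using this
  refine Metric.tendsto_nhds.2 fun ε hε => ?_
  have key : ∃ δ > 0, ∀ g' : Ω →ₘ[μ] Aut L M,
      ∫ ω, ∑' n, (1 / 2 : ℝ) ^ n * d g' n ω ∂μ < δ → dist g' g < ε := by
    refine exists_delta_of_seq (C := C') vint (fun g' ω => tsum_nonneg (d0 g' · ω))
      (fun g' => ((isBoundedMetric_compatibleDist _).integrable g' g).aestronglyMeasurable)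
      (fun g' ω => by
        rw [abs_of_nonneg ((isBoundedMetric_compatibleDist _).nonneg _ _)]; exact hC' _ _)
      (fun φ => ?_) hε
    filter_upwards [ae_all_iff.2 fun n => AEEqFun.coeFn_const (μ := μ) Ω (a n),
      ae_all_iff.2 fun n => coeFn_pointwiseAct g (AEEqFun.const Ω (a n)),
      ae_all_iff.2 fun k => ae_all_iff.2 fun n =>
        coeFn_pointwiseAct (φ k) (AEEqFun.const Ω (a n))] with ω h1 h2 h3 h4
    have hlim : Tendsto (fun k => φ k ω) atTop (𝓝 (g ω)) := by
      refine (isEmbedding_aut_apply ha).tendsto_nhds_iff.2 (tendsto_pi_nhds.2 fun n => ?_)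
      refine tendsto_iff_dist_tendsto_zero.2 ?_
      -- Each term of a nonnegative series is at most its sum; multiplying by `2 ^ n` removes the
      -- weight.
      have h5 : Tendsto (fun k => (1 / 2 : ℝ) ^ n * d (φ k) n ω) atTop (𝓝 0) :=
        squeeze_zero (fun k => d0 _ n ω)
          (fun k => (sumd (φ k) ω).le_tsum n fun j _ => d0 _ j ω) h4
      have h6 := h5.const_mul ((2 : ℝ) ^ n)
      rw [mul_zero] at h6
      refine h6.congr fun k => ?_
      rw [← mul_assoc, ← mul_pow]
      simp [d, h1, h2, h3]
    have hc : Continuous fun x : Aut L M => compatibleDist (Aut L M) x (g ω) :=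
      (isBoundedMetric_compatibleDist (Aut L M)).continuous.comp
        (continuous_id.prodMk continuous_const)
    have := (hc.tendsto (g ω)).comp hlim
    rwa [(isBoundedMetric_compatibleDist (Aut L M)).self] at this
  obtain ⟨δ, hδ, hδε⟩ := key
  filter_upwards [vlim.eventually (gt_mem_nhds hδ)] with i hi using hδε (f i) hi

end ContinuityOfActions

/-! ### The isomorphism is a homeomorphism. -/

section Homeomorphism

open Filter

variable {Ω : Type w} [MeasurableSpace Ω] {μ : Measure Ω} [IsProbabilityMeasure μ]
  {L : FirstOrder.Language.{u, v}} {M : Type w} [MetricSpace M] [BoundedSpace M]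
  [TopologicalSpace.SeparableSpace M] [Nonempty M] [MetricStructure L M]

omit [BoundedSpace M] [Nonempty M] in
theorem continuous_wreath_left :
    @Continuous _ _ _ (randomTopology μ (Aut L M))
      fun w : MeasurableWreath μ (Aut L M) => w.left := by
  let : TopologicalSpace (Ω →ₘ[μ] Aut L M) := randomTopology μ (Aut L M)
  exact continuous_fst.comp (continuous_induced_dom
    (f := fun w : MeasurableWreath μ (Aut L M) => (w.left, w.right)))

omit [BoundedSpace M] [Nonempty M] in
theorem continuous_wreath_right : Continuous fun w : MeasurableWreath μ (Aut L M) => w.right := by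
  let : TopologicalSpace (Ω →ₘ[μ] Aut L M) := randomTopology μ (Aut L M)
  exact continuous_snd.comp (continuous_induced_dom
    (f := fun w : MeasurableWreath μ (Aut L M) => (w.left, w.right)))

theorem tendsto_wreathMain (w : MeasurableWreath μ (Aut L M)) (r : Ω →ₘ[μ] M) :
    Tendsto (fun w' => ∫ ω, dist (wreathMain μ L M w' r ω) (wreathMain μ L M w r ω) ∂μ)
      (𝓝 w) (𝓝 0) := by
  have h1 := (tendsto_autAct w.right r).comp (continuous_wreath_right.tendsto w)
  have h2 := (tendsto_pointwiseAct w.left (autAct μ w.right r)).comp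
    (@Continuous.tendsto _ _ _ (randomTopology μ (Aut L M)) _ continuous_wreath_left w)
  have h3 := h1.add h2
  rw [add_zero] at h3
  let : MetricSpace (Ω →ₘ[μ] M) := integralMetric μ (isBoundedMetric_dist M)
  refine squeeze_zero (fun w' => integral_nonneg fun ω => dist_nonneg) (fun w' => ?_) h3
  -- The intermediate point uses the new left factor and the old right factor: the isometries
  -- `w'.left ω` cancel, and each remaining distance involves one varying factor.
  have e : ∫ ω, dist (pointwiseAct μ L M w'.left (autAct μ w'.right r) ω)
      (pointwiseAct μ L M w'.left (autAct μ w.right r) ω) ∂μ =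
      ∫ ω, dist (autAct μ w'.right r ω) (autAct μ w.right r ω) ∂μ := by
    refine integral_congr_ae ?_
    filter_upwards [coeFn_pointwiseAct w'.left (autAct μ w'.right r),
      coeFn_pointwiseAct w'.left (autAct μ w.right r)] with ω h4 h5
    rw [h4, h5, (w'.left ω).1.isometry.dist_eq]
  have := dist_triangle (wreathMain μ L M w' r)
    (pointwiseAct μ L M w'.left (autAct μ w.right r)) (wreathMain μ L M w r)
  exact this.trans_eq (congrArg (· + _) e)

theorem continuous_wreathHom : Continuous (wreathHom μ L M) := by
  refine Continuous.subtype_mk (continuous_pi fun s => continuous_isometry_iff.2 fun x =>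
    continuous_iff_continuousAt.2 fun w => tendsto_iff_dist_tendsto_zero.2 ?_) _
  cases s with
  | main => exact tendsto_wreathMain w x
  | aux => exact (tendsto_autAct_aux w.right x).comp (continuous_wreath_right.tendsto w)

theorem continuous_sort (s : RSort) (x : (borelRandomization μ L M).Carrier s) :
    Continuous fun σ : (borelRandomization μ L M).Aut => σ.1 s x :=
  (continuous_eval_isometry x).comp ((continuous_apply s).comp continuous_subtype_val)

/-- The left factor is tested on constants, on which `Aut(Ω)` acts trivially, and the right factor
on the auxiliary sort, where the left one is invisible. Both tests are evaluations of `σ`. -/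
theorem continuous_of_wreathHom_comp {e : (borelRandomization μ L M).Aut →
    MeasurableWreath μ (Aut L M)} (he : ∀ σ, wreathHom μ L M (e σ) = σ) : Continuous e := by
  let : TopologicalSpace (Ω →ₘ[μ] Aut L M) := randomTopology μ (Aut L M)
  refine continuous_induced_rng.2 (Continuous.prodMk ?_ ?_)
  · refine continuous_iff_continuousAt.2 fun σ => ?_
    refine tendsto_of_tendsto_pointwiseAct (TopologicalSpace.denseRange_denseSeq M) fun n => ?_
    have h := tendsto_iff_dist_tendsto_zero.1 ((continuous_sort RSort.main
      (AEEqFun.const Ω (TopologicalSpace.denseSeq M n))).tendsto σ)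
    refine h.congr fun σ' => ?_
    have key : ∀ σ, onMain σ (AEEqFun.const Ω (TopologicalSpace.denseSeq M n)) =
        pointwiseAct μ L M (e σ).left (AEEqFun.const Ω (TopologicalSpace.denseSeq M n)) := by
      intro σ
      conv_lhs => rw [← he σ]
      rw [onMain_wreathHom, wreathMain_apply, autAct_const]
    simp only [← key]
    rfl
  · let : MetricSpace (Ω →ₘ[μ] unitInterval) :=
      integralMetric μ (isBoundedMetric_dist unitInterval)
    refine continuous_induced_rng.2 (continuous_pi fun R => ?_)
    refine (continuous_sort RSort.aux R).congr fun σ => ?_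
    have := onAux_wreathHom (e σ) R
    rw [he] at this
    exact this

end Homeomorphism

end MetricRandomization

theorem mainTheorem1 {Ω : Type w} [MeasurableSpace Ω] [StandardBorelSpace Ω]
    (μ : Measure Ω) [IsProbabilityMeasure μ] [NullSingletonClass μ]
    (L : FirstOrder.Language.{u, v}) [Countable L.Symbols]
    (M : Type w) [MetricSpace M] [CompleteSpace M] [BoundedSpace M]
    [TopologicalSpace.SeparableSpace M] [Nontrivial M] [MetricStructure L M] :
    ∃ e : MeasurableWreath μ (Aut L M) ≃ₜ* (borelRandomization μ L M).Aut,
      ∀ (g : Ω →ₘ[μ] Aut L M) (t : measurePreservingPerms μ),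
        (∀ r : Ω →ₘ[μ] M,
          onMain (e ⟨g, (t : AutMeasure μ)⟩) r =ᵐ[μ]
            fun ω => (g ω : M ≃ᵢ M) (r (t.1.symm ω))) ∧
        ∀ R : Ω →ₘ[μ] unitInterval,
          onAux (e ⟨g, (t : AutMeasure μ)⟩) R =ᵐ[μ] fun ω => R (t.1.symm ω) := by
  let e := MulEquiv.ofBijective (wreathHom μ L M) ⟨wreathHom_injective, wreathHom_surjective⟩
  refine ⟨{ toMulEquiv := e
            continuous_toFun := continuous_wreathHom
            continuous_invFun := continuous_of_wreathHom_comp e.apply_symm_apply }, ?_⟩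
  exact fun g t => ⟨coeFn_wreathMain g t, coeFn_wreathAux g t⟩
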